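/- Let $K$ be a field of characteristic $2$ that is complete with respect to a discrete valuation, with valuation ring $\mathfrak{O}_K$, maximal ideal $\mathfrak{P}_K$ and perfect residue field. Let $L/K$ be a totally ramified Galois extension whose Galois group $G$ is isomorphic to $C_2\times C_2$ (so $[L:K]=4$), and let $\mathfrak{O}_L$ be the valuation ring of $L$, with maximal ideal $\mathfrak{P}_L$. For $j\in\mathbb{Z}$ put $G_j=\{\sigma\in G : (\sigma-1)\mathfrak{O}_L\subseteq \mathfrak{P}_L^{j+1}\}$, and let $b_1=\max\{j : |G_j|>2\}$ and $b_2=\max\{j : |G_j|>1\}$ be the lower ramification breaks of $L/K$. Let $h\in\mathbb{Z}$, and let $$\mathfrak{A}=\{\alpha\in K[G] : \alpha\cdot\mathfrak{P}_L^h\subseteq\mathfrak{P}_L^h\}$$ be the associated order of $\mathfrak{P}_L^h$, where $K[G]$ acts on $L$ by $\left(\sum_\sigma a_\sigma\sigma\right)\cdot x=\sum_\sigma a_\sigma\sigma(x)$. Then: 1. $\mathfrak{P}_L^h$ is a free $\mathfrak{A}$-module if and only if either $b_1\equiv 1 \pmod 4$ and $h\not\equiv 2\pmod 4$, or $b_1\equiv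 3\pmod 4$ and $h\not\equiv 1\pmod 4$. 2. If $\mathfrak{P}_L^h$ is not free over $\mathfrak{A}$, then the minimal number of generators of $\mathfrak{P}_L^h$ as an $\mathfrak{A}$-module is exactly $3$. 3. $\mathfrak{A}$ is a (commutative) local ring. If $\mathfrak{M}$ is its maximal ideal, then its embedding dimension $\dim_{\mathfrak{A}/\mathfrak{M}}(\mathfrak{M}/\mathfrak{M}^2)$ is $3$ if either $b_2\equiv 1\pmod 4$ and $h\equiv 1\pmod 2$, or $b_2\equiv 3\pmod 4$ and $h\equiv 0\pmod 2$; otherwise it is $4$. -/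

import Mathlib

open scoped nonZeroDivisors

noncomputable section

/-- The fractional ideal `𝔓 ^ h` (with `h : ℤ`) of a discrete valuation ring `S` with maximal
ideal `𝔓`, as an `S`-submodule of the fraction field `L`. -/
def primePow (S L : Type*) [CommRing S] [IsDomain S] [IsDiscreteValuationRing S]
    [Field L] [Algebra S L] [IsFractionRing S L] (h : ℤ) : Submodule S L :=
  (((IsLocalRing.maximalIdeal S : FractionalIdeal S⁰ L) ^ h : FractionalIdeal S⁰ L) :
    Submodule S L)

/-- The ramification group `G_j = {σ | (σ - 1) S ⊆ 𝔓 ^ (j + 1)}` in lower numbering; here `S` is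
the valuation ring of `L`, that is, the integral closure in `L` of the valuation ring `R`
of `K`. -/
def lowerRamificationGroup (R S K L : Type*) [CommRing R] [CommRing S] [IsDomain S]
    [IsDiscreteValuationRing S] [Field K] [Field L] [Algebra R K] [Algebra K L] [Algebra R L]
    [Algebra S L] [IsScalarTower R K L] [IsFractionRing S L] [IsIntegralClosure S R L]
    (j : ℤ) : Subgroup Gal(L/K) where
  carrier := {σ | ∀ x : S, σ (algebraMap S L x) - algebraMap S L x ∈ primePow S L (j + 1)}
  one_mem' := by intro x; simp
  mul_mem' := by
    intro σ τ hσ hτ x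
    have hx : IsIntegral R (algebraMap S L x) :=
      (IsIntegralClosure.isIntegral_iff (A := S)).2 ⟨x, rfl⟩
    obtain ⟨y, hy⟩ := (IsIntegralClosure.isIntegral_iff (A := S)).1
      (hx.map (τ.toAlgHom.restrictScalars R))
    have hy' : algebraMap S L y = τ (algebraMap S L x) := hy
    have h1 := hσ y
    have h2 := hτ x
    rw [hy'] at h1
    have h3 := add_mem h1 h2
    rw [sub_add_sub_cancel] at h3
    exact h3
  inv_mem' := by
    intro σ hσ x
    have hx : IsIntegral R (algebraMap S L x) :=
      (IsIntegralClosure.isIntegral_iff (A := S)).2 ⟨x, rfl⟩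
    obtain ⟨y, hy⟩ := (IsIntegralClosure.isIntegral_iff (A := S)).1
      (hx.map ((σ⁻¹).toAlgHom.restrictScalars R))
    have hy' : algebraMap S L y = σ⁻¹ (algebraMap S L x) := hy
    have h1 := neg_mem (hσ y)
    have h2 : σ (σ⁻¹ (algebraMap S L x)) = algebraMap S L x := AlgEquiv.apply_symm_apply σ _
    rw [hy', h2, neg_sub] at h1
    exact h1

/-- `b` is the `i`-th lower ramification break (`1 ≤ i ≤ n`, counted with multiplicity) of the
Galois extension `L/K` of degree `p ^ n`: `b = max {j | |G_j| > p ^ (n - i)}`. -/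
def IsLowerBreak (R S K L : Type*) [CommRing R] [CommRing S] [IsDomain S]
    [IsDiscreteValuationRing S] [Field K] [Field L] [Algebra R K] [Algebra K L] [Algebra R L]
    [Algebra S L] [IsScalarTower R K L] [IsFractionRing S L] [IsIntegralClosure S R L]
    (p n i : ℕ) (b : ℤ) : Prop :=
  IsGreatest {j : ℤ | p ^ (n - i) < Nat.card (lowerRamificationGroup R S K L j)} b

/-- The action of the group algebra `K[Gal(L/K)]` on `L`: `(∑ a_σ σ) · x = ∑ a_σ σ(x)`. -/
def galoisAlgebraAction (K L : Type*) [Field K] [Field L] [Algebra K L] :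
    MonoidAlgebra K Gal(L/K) →ₐ[K] Module.End K L :=
  MonoidAlgebra.lift K (Module.End K L) Gal(L/K)
    { toFun := fun σ => σ.toLinearMap
      map_one' := rfl
      map_mul' := fun _ _ => rfl }

/-- The associated order `{α ∈ K[Gal(L/K)] | α · I ⊆ I}` of a submodule `I` of `L`. -/
def associatedOrder (K : Type*) {S L : Type*} [CommRing S] [Field K] [Field L] [Algebra K L]
    [Algebra S L] (I : Submodule S L) : Subring (MonoidAlgebra K Gal(L/K)) where
  carrier := {α | ∀ x ∈ I, galoisAlgebraAction K L α x ∈ I}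
  one_mem' := by intro x hx; simpa using hx
  zero_mem' := by intro x _; simp
  mul_mem' := by
    intro α β hα hβ x hx
    rw [map_mul, Module.End.mul_apply]
    exact hα _ (hβ x hx)
  add_mem' := by
    intro α β hα hβ x hx
    rw [map_add, LinearMap.add_apply]
    exact add_mem (hα x hx) (hβ x hx)
  neg_mem' := by
    intro α hα x hx
    rw [map_neg, LinearMap.neg_apply]
    exact neg_mem (hα x hx)

/-- `I` as a module over its associated order, through the Galois action. -/
instance associatedOrderModule (K : Type*) {S L : Type*} [CommRing S] [Field K] [Field L]
    [Algebra K L] [Algebra S L] (I : Submodule S L) : Module (associatedOrder K I) I where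
  smul α x := ⟨galoisAlgebraAction K L α.1 x.1, α.2 x.1 x.2⟩
  one_smul x := Subtype.ext (by change galoisAlgebraAction K L 1 x.1 = x.1; simp)
  mul_smul α β x := Subtype.ext (by
    change galoisAlgebraAction K L (α.1 * β.1) x.1 = _
    rw [map_mul]; rfl)
  smul_zero α := Subtype.ext (by change galoisAlgebraAction K L α.1 0 = 0; simp)
  smul_add α x y := Subtype.ext (by
    change galoisAlgebraAction K L α.1 (x.1 + y.1) = _
    rw [map_add]; rfl)
  add_smul α β x := Subtype.ext (by
    change galoisAlgebraAction K L (α.1 + β.1) x.1 = _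
    rw [map_add]; rfl)
  zero_smul x := Subtype.ext (by change galoisAlgebraAction K L 0 x.1 = 0; simp)

/-- For a Galois group isomorphic to `C₂ × C₂` the associated order is commutative. -/
instance associatedOrderCommRing (K : Type*) {S L : Type*} [CommRing S] [Field K] [Field L]
    [Algebra K L] [Algebra S L] [IsKleinFour Gal(L/K)] (I : Submodule S L) :
    CommRing (associatedOrder K I) where
  __ := (inferInstance : Ring (associatedOrder K I))
  mul_comm α β := Subtype.ext (by
    have hG : ∀ σ τ : Gal(L/K), σ * τ = τ * σ :=
      fun σ τ => (IsKleinFour.isMulCommutative (G := Gal(L/K))).is_comm.comm σ τ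
    have key : ∀ a b : MonoidAlgebra K Gal(L/K), a * b = b * a := by
      intro a b
      induction a using MonoidAlgebra.induction_linear with
      | zero => simp
      | add f g hf hg => rw [add_mul, mul_add, hf, hg]
      | single σ r =>
        induction b using MonoidAlgebra.induction_linear with
        | zero => simp
        | add f g hf hg => rw [add_mul, mul_add, hf, hg]
        | single τ s =>
          rw [MonoidAlgebra.single_mul_single, MonoidAlgebra.single_mul_single, hG, mul_comm r s]
    exact key α.1 β.1)

end

/-!
Put `c₁ = b₁` and `c₂ = b₂`. The extension has a *Galois scaffold*: elements `x, y` of `L` and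
`μ` of `K` with `σ₁ x = x + 1`, `σ₂ x = x`, `σ₁ y = y + μ`, `σ₂ y = y + 1`, such that `1, x, y, x y`
have orders `0, -2 c₁, -c₂, -2 c₁ - c₂`. As `c₁` and `c₂` are odd and congruent modulo `4`, these
orders are incongruent modulo `4`. Hence the four monomials are a `K`-basis of `L` adapted to all
powers of the maximal ideal, and the breaks can be read off from the action of the Galois group on
them.

The scaffold comes from a maximality argument (`exists_isScaffold`). Take `x` of greatest order
among all elements outside `K` that every automorphism fixes or moves by `1`, and then `y` of
greatest order among the elements with `(σ₂ - 1) y = 1` and `(σ₁ - 1) y ∈ K`. In a totally ramified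
extension an element whose order is congruent modulo `4` to that of `z` can be improved by a
`K`-multiple of `z` (`exists_ord_sub_gt`). So the order of `x` is not divisible by `4`, that of `y`
is congruent neither to `0` nor to the order of `x`, and the Artin–Schreier equations for `x` and
`y` fix the rest.

In characteristic `2` the operators `Ψ₁ = σ₁ (1 + μ (σ₂ - 1)) - 1` and `Ψ₂ = σ₂ - 1` act on the
monomials as `∂/∂x` and `∂/∂y`, so that `K[G] = K[Ψ₁, Ψ₂] / (Ψ₁², Ψ₂²)` and `L = K[G] · x y`. It
follows that both `𝔓_L ^ h` and its associated order are spanned over the valuation ring of `K` by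
multiples of monomials (`IsScaffold.exists_isMonomialOrder`). If `𝔓_K ^ nᵢ` are the coefficients of
`𝔓_L ^ h`, with `nᵢ = ⌈(h - vᵢ) / 4⌉` for `vᵢ` the orders of `1, x, y, x y`, then everything depends
on the defect `n₀ + n₃ - n₁ - n₂ ∈ {-1, 0, 1}`. When it is at most `0`, the multiple of `x y`
generates `𝔓_L ^ h` freely; when it is `1`, Nakayama's lemma shows that the multiples of `x y`, `x`
and `y` are a minimal set of generators. The maximal ideal of the associated order is generated by a
uniformizer and the multiples of `Ψ₁`, `Ψ₂` and `Ψ₁ Ψ₂`, and the last of these is redundant exactly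
when the defect is `0`.
-/

/-! ### Minimal generators over a local ring -/

/-- Nakayama's lemma in coordinates: a finite generating family of `N` that is independent modulo
`𝔪 N` has the least possible number of elements. -/
theorem spanFinrank_eq_of_independent_mod {A M : Type*} [CommRing A] [IsLocalRing A]
    [AddCommGroup M] [Module A M] {n : ℕ} (N : Submodule A M) (g : Fin n → M)
    (hg : Submodule.span A (Set.range g) = N)
    (hmin : ∀ a : Fin n → A, ∑ i, a i • g i ∈ IsLocalRing.maximalIdeal A • N →
      ∀ i, a i ∈ IsLocalRing.maximalIdeal A) :
    N.spanFinrank = n := by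
  have hfg : N.FG := by rw [← hg]; exact Submodule.fg_span (Set.finite_range g)
  rw [IsLocalRing.spanFinrank_eq_finrank_quotient N hfg]
  have hgN : ∀ i, g i ∈ N := fun i => hg ▸ Submodule.subset_span ⟨i, rfl⟩
  let g' : Fin n → N := fun i => ⟨g i, hgN i⟩
  let q := (IsLocalRing.maximalIdeal A • (⊤ : Submodule A N)).mkQ
  have hsp : Submodule.span A (Set.range g') = ⊤ := by
    apply Submodule.map_injective_of_injective N.injective_subtype
    rw [Submodule.map_span, Submodule.map_top, Submodule.range_subtype, ← Set.range_comp]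
    exact hg
  let : Field (A ⧸ IsLocalRing.maximalIdeal A) := Ideal.Quotient.field _
  have hli : LinearIndependent (A ⧸ IsLocalRing.maximalIdeal A) (fun i => q (g' i)) := by
    rw [Fintype.linearIndependent_iff]
    intro c hc
    choose a ha using fun i => Ideal.Quotient.mk_surjective (I := IsLocalRing.maximalIdeal A) (c i)
    have h1 : q (∑ i, a i • g' i) = 0 := by
      rw [map_sum, ← hc]
      refine Finset.sum_congr rfl fun i _ => ?_
      rw [← ha i, map_smul]
      rfl
    rw [← LinearMap.mem_ker, Submodule.ker_mkQ, Submodule.mem_smul_top_iff] at h1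
    have h2 := hmin a (by simpa [g'] using h1)
    intro i
    rw [← ha i, Ideal.Quotient.eq_zero_iff_mem]
    exact h2 i
  have hsp' : ⊤ ≤ Submodule.span (A ⧸ IsLocalRing.maximalIdeal A)
      (Set.range (fun i => q (g' i))) := by
    intro y _
    obtain ⟨x, rfl⟩ := Submodule.mkQ_surjective _ y
    have hx : x ∈ Submodule.span A (Set.range g') := hsp ▸ Submodule.mem_top
    obtain ⟨c, rfl⟩ := (Submodule.mem_span_range_iff_exists_fun A).1 hx
    rw [map_sum]
    refine Submodule.sum_mem _ fun i _ => ?_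
    rw [map_smul]
    exact Submodule.smul_mem (Submodule.span (A ⧸ IsLocalRing.maximalIdeal A)
      (Set.range (fun i => q (g' i)))) (Ideal.Quotient.mk _ (c i)) (Submodule.subset_span ⟨i, rfl⟩)
  rw [Module.finrank_eq_card_basis (Module.Basis.mk hli hsp'), Fintype.card_fin]

/-! ### Monomial orders of rank four -/

/-- `A` is free over `R` on `1, Φ₁, Φ₂, Φ₃` with multiplication `Φ₁² = Φ₂² = 0`,
`Φ₁ Φ₂ = k Φ₃`, and `Φ₃` annihilating `Φ₁, Φ₂, Φ₃`. This is an `R`-lattice spanned by multiples of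
the monomials in `Frac R [X, Y] / (X², Y²)`. The structure map is a bare ring homomorphism `ι`, so
that no `R`-algebra instance on `A` is needed. -/
structure IsMonomialOrder {R A : Type*} [CommRing R] [CommRing A] (ι : R →+* A)
    (Φ₁ Φ₂ Φ₃ : A) (k : R) : Prop where
  exists_coord : ∀ a, ∃ r₀ r₁ r₂ r₃, a = ι r₀ + ι r₁ * Φ₁ + ι r₂ * Φ₂ + ι r₃ * Φ₃
  coord_eq_zero : ∀ r₀ r₁ r₂ r₃, ι r₀ + ι r₁ * Φ₁ + ι r₂ * Φ₂ + ι r₃ * Φ₃ = 0 →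
    r₀ = 0 ∧ r₁ = 0 ∧ r₂ = 0 ∧ r₃ = 0
  sq₁ : Φ₁ * Φ₁ = 0
  sq₂ : Φ₂ * Φ₂ = 0
  mul₁₂ : Φ₁ * Φ₂ = ι k * Φ₃
  mul₁₃ : Φ₁ * Φ₃ = 0
  mul₂₃ : Φ₂ * Φ₃ = 0
  sq₃ : Φ₃ * Φ₃ = 0

/-- `M` is a module over a monomial order, free over `R` on `E₀, E₁, E₂, E₃`, on which `Φ₁, Φ₂, Φ₃`
act by shifting the basis: up to scalars, `Φ₁ : E₃ ↦ E₂, E₁ ↦ E₀`, `Φ₂ : E₃ ↦ E₁, E₂ ↦ E₀` and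
`Φ₃ : E₃ ↦ E₀`. -/
structure IsMonomialModule {R A M : Type*} [CommRing R] [CommRing A] [AddCommGroup M] [Module A M]
    (ι : R →+* A) (Φ₁ Φ₂ Φ₃ : A) (E₀ E₁ E₂ E₃ : M) (a b c d : R) : Prop where
  exists_coord : ∀ m, ∃ r₀ r₁ r₂ r₃, m = ι r₀ • E₀ + ι r₁ • E₁ + ι r₂ • E₂ + ι r₃ • E₃
  coord_eq_zero : ∀ r₀ r₁ r₂ r₃, ι r₀ • E₀ + ι r₁ • E₁ + ι r₂ • E₂ + ι r₃ • E₃ = 0 →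
    r₀ = 0 ∧ r₁ = 0 ∧ r₂ = 0 ∧ r₃ = 0
  smul₁₀ : Φ₁ • E₀ = 0
  smul₁₁ : Φ₁ • E₁ = ι c • E₀
  smul₁₂ : Φ₁ • E₂ = 0
  smul₁₃ : Φ₁ • E₃ = ι a • E₂
  smul₂₀ : Φ₂ • E₀ = 0
  smul₂₁ : Φ₂ • E₁ = 0
  smul₂₂ : Φ₂ • E₂ = ι d • E₀
  smul₂₃ : Φ₂ • E₃ = ι b • E₁
  smul₃₀ : Φ₃ • E₀ = 0
  smul₃₁ : Φ₃ • E₁ = 0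
  smul₃₂ : Φ₃ • E₂ = 0
  smul₃₃ : Φ₃ • E₃ = E₀

namespace IsMonomialOrder

variable {R A : Type*} [CommRing R] [CommRing A] {ι : R →+* A} {Φ₁ Φ₂ Φ₃ : A} {k : R}

theorem coord_unique (H : IsMonomialOrder ι Φ₁ Φ₂ Φ₃ k) {r₀ r₁ r₂ r₃ s₀ s₁ s₂ s₃ : R}
    (h : ι r₀ + ι r₁ * Φ₁ + ι r₂ * Φ₂ + ι r₃ * Φ₃ = ι s₀ + ι s₁ * Φ₁ + ι s₂ * Φ₂ + ι s₃ * Φ₃) :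
    r₀ = s₀ ∧ r₁ = s₁ ∧ r₂ = s₂ ∧ r₃ = s₃ := by
  have := H.coord_eq_zero (r₀ - s₀) (r₁ - s₁) (r₂ - s₂) (r₃ - s₃)
    (by simp only [map_sub]; linear_combination h)
  simpa only [sub_eq_zero] using this

theorem mul_coord (H : IsMonomialOrder ι Φ₁ Φ₂ Φ₃ k) (r₀ r₁ r₂ r₃ s₀ s₁ s₂ s₃ : R) :
    (ι r₀ + ι r₁ * Φ₁ + ι r₂ * Φ₂ + ι r₃ * Φ₃) * (ι s₀ + ι s₁ * Φ₁ + ι s₂ * Φ₂ + ι s₃ * Φ₃) =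
      ι (r₀ * s₀) + ι (r₀ * s₁ + r₁ * s₀) * Φ₁ + ι (r₀ * s₂ + r₂ * s₀) * Φ₂ +
        ι (r₀ * s₃ + r₃ * s₀ + k * (r₁ * s₂ + r₂ * s₁)) * Φ₃ := by
  simp only [map_add, map_mul]
  linear_combination (ι r₁ * ι s₁) * H.sq₁ + (ι r₂ * ι s₂) * H.sq₂ +
    (ι r₁ * ι s₂ + ι r₂ * ι s₁) * H.mul₁₂ + (ι r₁ * ι s₃ + ι r₃ * ι s₁) * H.mul₁₃ +
    (ι r₂ * ι s₃ + ι r₃ * ι s₂) * H.mul₂₃ + (ι r₃ * ι s₃) * H.sq₃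

theorem isUnit_of_isUnit (H : IsMonomialOrder ι Φ₁ Φ₂ Φ₃ k) {r₀ : R} (h : IsUnit r₀)
    (r₁ r₂ r₃ : R) : IsUnit (ι r₀ + ι r₁ * Φ₁ + ι r₂ * Φ₂ + ι r₃ * Φ₃) := by
  have h1 : IsNilpotent (ι r₁ * Φ₁ + ι r₂ * Φ₂ + ι r₃ * Φ₃) := by
    have hnil : ∀ {x : A} (r : A), x * x = 0 → IsNilpotent (r * x) := fun r hx =>
      (Commute.all _ _).isNilpotent_mul_left ⟨2, by rw [pow_two, hx]⟩
    exact (Commute.all _ _).isNilpotent_add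
      ((Commute.all _ _).isNilpotent_add (hnil _ H.sq₁) (hnil _ H.sq₂)) (hnil _ H.sq₃)
  have h2 := h1.isUnit_add_left_of_commute (h.map ι) (Commute.all _ _)
  convert h2 using 1
  ring

theorem isUnit_iff (H : IsMonomialOrder ι Φ₁ Φ₂ Φ₃ k) {r₀ r₁ r₂ r₃ : R} :
    IsUnit (ι r₀ + ι r₁ * Φ₁ + ι r₂ * Φ₂ + ι r₃ * Φ₃) ↔ IsUnit r₀ := by
  refine ⟨fun h => ?_, fun h => H.isUnit_of_isUnit h _ _ _⟩
  obtain ⟨y, hy⟩ := h.exists_right_inv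
  obtain ⟨s₀, s₁, s₂, s₃, rfl⟩ := H.exists_coord y
  rw [H.mul_coord] at hy
  have := (H.coord_unique (s₀ := 1) (s₁ := 0) (s₂ := 0) (s₃ := 0)
    (by rw [hy]; simp)).1
  exact IsUnit.of_mul_eq_one _ this

theorem isLocalRing [IsLocalRing R] (H : IsMonomialOrder ι Φ₁ Φ₂ Φ₃ k) : IsLocalRing A := by
  have : Nontrivial A := by
    by_contra hA
    rw [not_nontrivial_iff_subsingleton] at hA
    exact one_ne_zero (H.coord_eq_zero 1 0 0 0 (Subsingleton.elim _ _)).1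
  refine IsLocalRing.of_isUnit_or_isUnit_one_sub_self fun a => ?_
  obtain ⟨r₀, r₁, r₂, r₃, rfl⟩ := H.exists_coord a
  have h1 : 1 - (ι r₀ + ι r₁ * Φ₁ + ι r₂ * Φ₂ + ι r₃ * Φ₃) =
      ι (1 - r₀) + ι (-r₁) * Φ₁ + ι (-r₂) * Φ₂ + ι (-r₃) * Φ₃ := by
    simp only [map_sub, map_neg, map_one]; ring
  rw [h1, H.isUnit_iff, H.isUnit_iff]
  exact IsLocalRing.isUnit_or_isUnit_one_sub_self r₀

variable [IsDomain R] [IsDiscreteValuationRing R] [IsLocalRing A] {p : R}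

theorem mem_maximalIdeal_iff (H : IsMonomialOrder ι Φ₁ Φ₂ Φ₃ k) (hp : Irreducible p)
    {r₀ r₁ r₂ r₃ : R} :
    ι r₀ + ι r₁ * Φ₁ + ι r₂ * Φ₂ + ι r₃ * Φ₃ ∈ IsLocalRing.maximalIdeal A ↔ p ∣ r₀ := by
  rw [IsLocalRing.mem_maximalIdeal, mem_nonunits_iff, H.isUnit_iff, ← mem_nonunits_iff,
    ← IsLocalRing.mem_maximalIdeal, hp.maximalIdeal_eq, Ideal.mem_span_singleton]

theorem generators_mem (H : IsMonomialOrder ι Φ₁ Φ₂ Φ₃ k) (hp : Irreducible p) :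
    ι p ∈ IsLocalRing.maximalIdeal A ∧ Φ₁ ∈ IsLocalRing.maximalIdeal A ∧
      Φ₂ ∈ IsLocalRing.maximalIdeal A ∧ Φ₃ ∈ IsLocalRing.maximalIdeal A := by
  refine ⟨?_, ?_, ?_, ?_⟩
  · simpa using (H.mem_maximalIdeal_iff hp (r₀ := p) (r₁ := 0) (r₂ := 0) (r₃ := 0)).2 dvd_rfl
  · simpa using (H.mem_maximalIdeal_iff hp (r₀ := 0) (r₁ := 1) (r₂ := 0) (r₃ := 0)).2 (dvd_zero _)
  · simpa using (H.mem_maximalIdeal_iff hp (r₀ := 0) (r₁ := 0) (r₂ := 1) (r₃ := 0)).2 (dvd_zero _)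
  · simpa using (H.mem_maximalIdeal_iff hp (r₀ := 0) (r₁ := 0) (r₂ := 0) (r₃ := 1)).2 (dvd_zero _)

theorem dvd_of_mem_maximalIdeal_mul_self (H : IsMonomialOrder ι Φ₁ Φ₂ Φ₃ k)
    (hp : Irreducible p) {r₀ r₁ r₂ r₃ : R}
    (h : ι r₀ + ι r₁ * Φ₁ + ι r₂ * Φ₂ + ι r₃ * Φ₃ ∈
      IsLocalRing.maximalIdeal A * IsLocalRing.maximalIdeal A) :
    p * p ∣ r₀ ∧ p ∣ r₁ ∧ p ∣ r₂ ∧ (p ∣ k → p ∣ r₃) := by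
  suffices hs : ∀ x ∈ IsLocalRing.maximalIdeal A * IsLocalRing.maximalIdeal A,
      ∃ s₀ s₁ s₂ s₃, x = ι s₀ + ι s₁ * Φ₁ + ι s₂ * Φ₂ + ι s₃ * Φ₃ ∧
        p * p ∣ s₀ ∧ p ∣ s₁ ∧ p ∣ s₂ ∧ (p ∣ k → p ∣ s₃) by
    obtain ⟨s₀, s₁, s₂, s₃, hx, hs⟩ := hs _ h
    obtain ⟨rfl, rfl, rfl, rfl⟩ := H.coord_unique hx
    exact hs
  intro x hx
  induction hx using Submodule.mul_induction_on' with
  | mem_mul_mem x hx y hy =>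
    obtain ⟨r₀, r₁, r₂, r₃, rfl⟩ := H.exists_coord x
    obtain ⟨s₀, s₁, s₂, s₃, rfl⟩ := H.exists_coord y
    rw [H.mem_maximalIdeal_iff hp] at hx hy
    refine ⟨_, _, _, _, H.mul_coord _ _ _ _ _ _ _ _, mul_dvd_mul hx hy, ?_, ?_, fun hk => ?_⟩
    · exact dvd_add (hx.mul_right _) (hy.mul_left _)
    · exact dvd_add (hx.mul_right _) (hy.mul_left _)
    · exact dvd_add (dvd_add (hx.mul_right _) (hy.mul_left _)) (hk.mul_right _)
  | add x _ y _ hx hy =>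
    obtain ⟨r₀, r₁, r₂, r₃, rfl, h₀, h₁, h₂, h₃⟩ := hx
    obtain ⟨s₀, s₁, s₂, s₃, rfl, h₀', h₁', h₂', h₃'⟩ := hy
    refine ⟨r₀ + s₀, r₁ + s₁, r₂ + s₂, r₃ + s₃, by simp only [map_add]; ring, dvd_add h₀ h₀',
      dvd_add h₁ h₁', dvd_add h₂ h₂', fun hk => dvd_add (h₃ hk) (h₃' hk)⟩

/-- If `k` is not a unit, then `p, Φ₁, Φ₂, Φ₃` minimally generate the maximal ideal. -/
theorem finrank_cotangentSpace_of_dvd (H : IsMonomialOrder ι Φ₁ Φ₂ Φ₃ k) (hp : Irreducible p)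
    (hk : p ∣ k) :
    Module.finrank (IsLocalRing.ResidueField A) (IsLocalRing.CotangentSpace A) = 4 := by
  have hm := H.generators_mem hp
  have hspan : Submodule.span A (Set.range ![ι p, Φ₁, Φ₂, Φ₃]) = IsLocalRing.maximalIdeal A := by
    apply le_antisymm
    · rw [Submodule.span_le]
      rintro _ ⟨i, rfl⟩
      fin_cases i
      exacts [hm.1, hm.2.1, hm.2.2.1, hm.2.2.2]
    · intro x hx
      obtain ⟨r₀, r₁, r₂, r₃, rfl⟩ := H.exists_coord x
      obtain ⟨r, rfl⟩ := (H.mem_maximalIdeal_iff hp).1 hx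
      refine (Submodule.mem_span_range_iff_exists_fun A).2 ⟨![ι r, ι r₁, ι r₂, ι r₃], ?_⟩
      simp [Fin.sum_univ_four]
      ring
  have hfg : (IsLocalRing.maximalIdeal A).FG := by
    rw [← hspan]; exact Submodule.fg_span (Set.finite_range _)
  rw [← IsLocalRing.spanFinrank_maximalIdeal_eq_finrank_cotangentSpace_of_fg hfg]
  refine spanFinrank_eq_of_independent_mod _ _ hspan fun a ha => ?_
  choose r₀ r₁ r₂ r₃ hr using fun i => H.exists_coord (a i)
  have e : ∑ i, a i • ![ι p, Φ₁, Φ₂, Φ₃] i = ι (r₀ 0 * p) + ι (r₁ 0 * p + r₀ 1) * Φ₁ +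
      ι (r₂ 0 * p + r₀ 2) * Φ₂ + ι (r₃ 0 * p + r₀ 3 + k * (r₂ 1 + r₁ 2)) * Φ₃ := by
    simp only [Fin.sum_univ_four, smul_eq_mul, Matrix.cons_val, hr 0, hr 1, hr 2, hr 3, map_add,
      map_mul]
    linear_combination (ι (r₁ 1)) * H.sq₁ + (ι (r₂ 2)) * H.sq₂ +
      (ι (r₂ 1) + ι (r₁ 2)) * H.mul₁₂ + (ι (r₃ 1) + ι (r₁ 3)) * H.mul₁₃ +
      (ι (r₃ 2) + ι (r₂ 3)) * H.mul₂₃ + ι (r₃ 3) * H.sq₃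
  rw [e, smul_eq_mul] at ha
  obtain ⟨h₀, h₁, h₂, h₃⟩ := H.dvd_of_mem_maximalIdeal_mul_self hp ha
  intro i
  rw [hr i, H.mem_maximalIdeal_iff hp]
  fin_cases i
  · exact (mul_dvd_mul_iff_right hp.ne_zero).1 h₀
  · exact (dvd_add_right (dvd_mul_left p _)).1 h₁
  · exact (dvd_add_right (dvd_mul_left p _)).1 h₂
  · exact (dvd_add_right (dvd_mul_left p _)).1 ((dvd_add_left (hk.mul_right _)).1 (h₃ hk))

/-- If `k` is a unit, then `Φ₃` is a multiple of `Φ₁ Φ₂`, and `p, Φ₁, Φ₂` minimally generate the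
maximal ideal. -/
theorem finrank_cotangentSpace_of_isUnit (H : IsMonomialOrder ι Φ₁ Φ₂ Φ₃ k) (hp : Irreducible p)
    (hk : IsUnit k) :
    Module.finrank (IsLocalRing.ResidueField A) (IsLocalRing.CotangentSpace A) = 3 := by
  have hm := H.generators_mem hp
  obtain ⟨k', hk'⟩ := hk.exists_left_inv
  have hspan : Submodule.span A (Set.range ![ι p, Φ₁, Φ₂]) = IsLocalRing.maximalIdeal A := by
    apply le_antisymm
    · rw [Submodule.span_le]
      rintro _ ⟨i, rfl⟩
      fin_cases i
      exacts [hm.1, hm.2.1, hm.2.2.1]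
    · intro x hx
      obtain ⟨r₀, r₁, r₂, r₃, rfl⟩ := H.exists_coord x
      obtain ⟨r, rfl⟩ := (H.mem_maximalIdeal_iff hp).1 hx
      refine (Submodule.mem_span_range_iff_exists_fun A).2
        ⟨![ι r, ι r₁, ι r₂ + ι (r₃ * k') * Φ₁], ?_⟩
      have hk₁ : ι k' * ι k = 1 := by rw [← map_mul, hk', map_one]
      simp only [Fin.sum_univ_three, smul_eq_mul, Matrix.cons_val, map_mul]
      linear_combination (ι r₃ * ι k') * H.mul₁₂ + (ι r₃ * Φ₃) * hk₁
  have hfg : (IsLocalRing.maximalIdeal A).FG := by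
    rw [← hspan]; exact Submodule.fg_span (Set.finite_range _)
  rw [← IsLocalRing.spanFinrank_maximalIdeal_eq_finrank_cotangentSpace_of_fg hfg]
  refine spanFinrank_eq_of_independent_mod _ _ hspan fun a ha => ?_
  choose r₀ r₁ r₂ r₃ hr using fun i => H.exists_coord (a i)
  have e : ∑ i, a i • ![ι p, Φ₁, Φ₂] i = ι (r₀ 0 * p) + ι (r₁ 0 * p + r₀ 1) * Φ₁ +
      ι (r₂ 0 * p + r₀ 2) * Φ₂ + ι (r₃ 0 * p + k * (r₂ 1 + r₁ 2)) * Φ₃ := by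
    simp only [Fin.sum_univ_three, smul_eq_mul, Matrix.cons_val, hr 0, hr 1, hr 2, map_add,
      map_mul]
    linear_combination (ι (r₁ 1)) * H.sq₁ + (ι (r₂ 2)) * H.sq₂ +
      (ι (r₂ 1) + ι (r₁ 2)) * H.mul₁₂ + (ι (r₃ 1)) * H.mul₁₃ + (ι (r₃ 2)) * H.mul₂₃
  rw [e, smul_eq_mul] at ha
  obtain ⟨h₀, h₁, h₂, -⟩ := H.dvd_of_mem_maximalIdeal_mul_self hp ha
  intro i
  rw [hr i, H.mem_maximalIdeal_iff hp]
  fin_cases i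
  · exact (mul_dvd_mul_iff_right hp.ne_zero).1 h₀
  · exact (dvd_add_right (dvd_mul_left p _)).1 h₁
  · exact (dvd_add_right (dvd_mul_left p _)).1 h₂

end IsMonomialOrder

namespace IsMonomialModule

variable {R A M : Type*} [CommRing R] [CommRing A] [AddCommGroup M] [Module A M] {ι : R →+* A}
  {Φ₁ Φ₂ Φ₃ : A} {E₀ E₁ E₂ E₃ : M} {a b c d k : R}

theorem coord_unique (H : IsMonomialModule ι Φ₁ Φ₂ Φ₃ E₀ E₁ E₂ E₃ a b c d)
    {r₀ r₁ r₂ r₃ s₀ s₁ s₂ s₃ : R}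
    (h : ι r₀ • E₀ + ι r₁ • E₁ + ι r₂ • E₂ + ι r₃ • E₃ =
      ι s₀ • E₀ + ι s₁ • E₁ + ι s₂ • E₂ + ι s₃ • E₃) :
    r₀ = s₀ ∧ r₁ = s₁ ∧ r₂ = s₂ ∧ r₃ = s₃ := by
  have := H.coord_eq_zero (r₀ - s₀) (r₁ - s₁) (r₂ - s₂) (r₃ - s₃)
    (by simp only [map_sub, sub_smul]; rw [← sub_eq_zero] at h; rw [← h]; abel)
  simpa only [sub_eq_zero] using this

theorem smul_coord (H : IsMonomialModule ι Φ₁ Φ₂ Φ₃ E₀ E₁ E₂ E₃ a b c d)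
    (s₀ s₁ s₂ s₃ r₀ r₁ r₂ r₃ : R) :
    (ι s₀ + ι s₁ * Φ₁ + ι s₂ * Φ₂ + ι s₃ * Φ₃) •
        (ι r₀ • E₀ + ι r₁ • E₁ + ι r₂ • E₂ + ι r₃ • E₃) =
      ι (s₀ * r₀ + s₁ * r₁ * c + s₂ * r₂ * d + s₃ * r₃) • E₀ + ι (s₀ * r₁ + s₂ * r₃ * b) • E₁ +
        ι (s₀ * r₂ + s₁ * r₃ * a) • E₂ + ι (s₀ * r₃) • E₃ := by
  have e : ∀ (r : R) (m : M), (ι s₀ + ι s₁ * Φ₁ + ι s₂ * Φ₂ + ι s₃ * Φ₃) • ι r • m =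
      ι (s₀ * r) • m + ι (s₁ * r) • Φ₁ • m + ι (s₂ * r) • Φ₂ • m + ι (s₃ * r) • Φ₃ • m :=
    fun r m => by
      simp only [smul_smul, ← add_smul, map_mul]
      congr 1
      ring
  simp only [smul_add, e, H.smul₁₀, H.smul₁₁, H.smul₁₂, H.smul₁₃, H.smul₂₀, H.smul₂₁,
    H.smul₂₂, H.smul₂₃, H.smul₃₀, H.smul₃₁, H.smul₃₂, H.smul₃₃, smul_zero, map_add, map_mul,
    smul_smul, add_smul]
  abel

/-- If `Φ₁` and `Φ₂` carry `E₃` to unit multiples of `E₂` and `E₁`, then `E₃` is a free generator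
of `M`. -/
theorem free_of_isUnit (HA : IsMonomialOrder ι Φ₁ Φ₂ Φ₃ k)
    (H : IsMonomialModule ι Φ₁ Φ₂ Φ₃ E₀ E₁ E₂ E₃ a b c d) (ha : IsUnit a) (hb : IsUnit b) :
    Module.Free A M := by
  have key : ∀ s₀ s₁ s₂ s₃ : R, (ι s₀ + ι s₁ * Φ₁ + ι s₂ * Φ₂ + ι s₃ * Φ₃) • E₃ =
      ι s₃ • E₀ + ι (s₂ * b) • E₁ + ι (s₁ * a) • E₂ + ι s₀ • E₃ := fun s₀ s₁ s₂ s₃ => by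
    simpa using H.smul_coord s₀ s₁ s₂ s₃ 0 0 0 1
  refine Module.Free.of_equiv (LinearEquiv.ofBijective (LinearMap.toSpanSingleton A M E₃) ⟨?_, ?_⟩)
  · rw [injective_iff_map_eq_zero]
    intro x hx
    obtain ⟨s₀, s₁, s₂, s₃, rfl⟩ := HA.exists_coord x
    rw [LinearMap.toSpanSingleton_apply, key] at hx
    obtain ⟨h₀, h₁, h₂, h₃⟩ := H.coord_eq_zero _ _ _ _ hx
    rw [hb.mul_left_eq_zero] at h₁
    rw [ha.mul_left_eq_zero] at h₂
    simp [h₀, h₁, h₂, h₃]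
  · intro m
    obtain ⟨r₀, r₁, r₂, r₃, rfl⟩ := H.exists_coord m
    obtain ⟨a', ha'⟩ := ha.exists_left_inv
    obtain ⟨b', hb'⟩ := hb.exists_left_inv
    refine ⟨ι r₃ + ι (r₂ * a') * Φ₁ + ι (r₁ * b') * Φ₂ + ι r₀ * Φ₃, ?_⟩
    rw [LinearMap.toSpanSingleton_apply, key, mul_assoc, mul_assoc, ha', hb', mul_one, mul_one]

/-- `Φ₃` has rank one on `M`, so `M` has no two independent elements. -/
theorem subsingleton_of_basis [IsDomain R] (HA : IsMonomialOrder ι Φ₁ Φ₂ Φ₃ k)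
    (H : IsMonomialModule ι Φ₁ Φ₂ Φ₃ E₀ E₁ E₂ E₃ a b c d) {I : Type*} (B : Module.Basis I A M) :
    Subsingleton I := by
  have hΦ₃ : ∀ r : R, ι r * Φ₃ = 0 → r = 0 := fun r hr =>
    (HA.coord_eq_zero 0 0 0 r (by simpa using hr)).2.2.2
  have key : ∀ m : M, ∃ r : R, Φ₃ • m = ι r • E₀ := fun m => by
    obtain ⟨r₀, r₁, r₂, r₃, rfl⟩ := H.exists_coord m
    exact ⟨r₃, by simpa using H.smul_coord 0 0 0 1 r₀ r₁ r₂ r₃⟩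
  refine ⟨fun i j => ?_⟩
  by_contra hij
  obtain ⟨r, hr⟩ := key (B i)
  obtain ⟨s, hs⟩ := key (B j)
  have h1 : (ι s * Φ₃) • B i = (ι r * Φ₃) • B j := by
    rw [mul_smul, mul_smul, hr, hs, smul_smul, smul_smul, mul_comm]
  have h2 := congrArg (fun m => B.repr m i) h1
  have h3 : s = 0 := hΦ₃ s (by simpa [Finsupp.single_apply, Ne.symm hij] using h2)
  rw [h3, map_zero, zero_smul] at hs
  have h4 := congrArg (fun m => B.repr m j) hs
  exact one_ne_zero (hΦ₃ 1 (by simpa using h4))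

variable [IsDomain R] [IsDiscreteValuationRing R] [IsLocalRing A] {p : R}

theorem dvd_of_mem_maximalIdeal_smul (HA : IsMonomialOrder ι Φ₁ Φ₂ Φ₃ k)
    (H : IsMonomialModule ι Φ₁ Φ₂ Φ₃ E₀ E₁ E₂ E₃ a b c d) (hp : Irreducible p)
    (ha : p ∣ a) (hb : p ∣ b) {r₀ r₁ r₂ r₃ : R}
    (h : ι r₀ • E₀ + ι r₁ • E₁ + ι r₂ • E₂ + ι r₃ • E₃ ∈
      IsLocalRing.maximalIdeal A • (⊤ : Submodule A M)) :
    p ∣ r₁ ∧ p ∣ r₂ ∧ p ∣ r₃ := by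
  suffices hs : ∀ x ∈ IsLocalRing.maximalIdeal A • (⊤ : Submodule A M),
      ∃ s₀ s₁ s₂ s₃, x = ι s₀ • E₀ + ι s₁ • E₁ + ι s₂ • E₂ + ι s₃ • E₃ ∧
        p ∣ s₁ ∧ p ∣ s₂ ∧ p ∣ s₃ by
    obtain ⟨s₀, s₁, s₂, s₃, hx, hs⟩ := hs _ h
    obtain ⟨rfl, rfl, rfl, rfl⟩ := H.coord_unique hx
    exact hs
  intro x hx
  induction hx using Submodule.smul_induction_on' with
  | smul x hx y hy =>
    obtain ⟨s₀, s₁, s₂, s₃, rfl⟩ := HA.exists_coord x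
    obtain ⟨r₀, r₁, r₂, r₃, rfl⟩ := H.exists_coord y
    rw [HA.mem_maximalIdeal_iff hp] at hx
    refine ⟨_, _, _, _, H.smul_coord _ _ _ _ _ _ _ _, ?_, ?_, hx.mul_right _⟩
    · exact dvd_add (hx.mul_right _) (hb.mul_left _)
    · exact dvd_add (hx.mul_right _) (ha.mul_left _)
  | add x _ y _ hx hy =>
    obtain ⟨r₀, r₁, r₂, r₃, rfl, h₁, h₂, h₃⟩ := hx
    obtain ⟨s₀, s₁, s₂, s₃, rfl, h₁', h₂', h₃'⟩ := hy
    refine ⟨r₀ + s₀, r₁ + s₁, r₂ + s₂, r₃ + s₃, by simp only [map_add, add_smul]; abel,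
      dvd_add h₁ h₁', dvd_add h₂ h₂', dvd_add h₃ h₃'⟩

/-- If the multiples of `E₂` and `E₁` to which `Φ₁` and `Φ₂` carry `E₃` are not unit multiples, then
`E₃, E₁, E₂` minimally generate `M`. -/
theorem spanRank_of_dvd (HA : IsMonomialOrder ι Φ₁ Φ₂ Φ₃ k)
    (H : IsMonomialModule ι Φ₁ Φ₂ Φ₃ E₀ E₁ E₂ E₃ a b c d) (hp : Irreducible p)
    (ha : p ∣ a) (hb : p ∣ b) : (⊤ : Submodule A M).spanRank = 3 := by
  have hspan : Submodule.span A (Set.range ![E₃, E₁, E₂]) = ⊤ := by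
    rw [eq_top_iff]
    intro x _
    obtain ⟨r₀, r₁, r₂, r₃, rfl⟩ := H.exists_coord x
    refine (Submodule.mem_span_range_iff_exists_fun A).2
      ⟨![ι r₃ + ι r₀ * Φ₃, ι r₁, ι r₂], ?_⟩
    simp only [Fin.sum_univ_three, Matrix.cons_val, add_smul, mul_smul, H.smul₃₃]
    abel
  have hfg : (⊤ : Submodule A M).FG := by
    rw [← hspan]; exact Submodule.fg_span (Set.finite_range _)
  refine (hfg.spanRank_eq_iff 3).2 ?_
  refine spanFinrank_eq_of_independent_mod _ _ hspan fun x hx => ?_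
  choose r₀ r₁ r₂ r₃ hr using fun i => HA.exists_coord (x i)
  have e : ∑ i, x i • ![E₃, E₁, E₂] i = ι (r₃ 0 + r₁ 1 * c + r₂ 2 * d) • E₀ +
      ι (r₂ 0 * b + r₀ 1) • E₁ + ι (r₁ 0 * a + r₀ 2) • E₂ + ι (r₀ 0) • E₃ := by
    have e₃ := H.smul_coord (r₀ 0) (r₁ 0) (r₂ 0) (r₃ 0) 0 0 0 1
    have e₁ := H.smul_coord (r₀ 1) (r₁ 1) (r₂ 1) (r₃ 1) 0 1 0 0
    have e₂ := H.smul_coord (r₀ 2) (r₁ 2) (r₂ 2) (r₃ 2) 0 0 1 0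
    simp only [map_zero, map_one, zero_smul, one_smul, zero_add, add_zero, mul_zero, mul_one,
      zero_mul] at e₁ e₂ e₃
    simp only [Fin.sum_univ_three, Matrix.cons_val, hr 0, hr 1, hr 2, e₁, e₂, e₃, map_add,
      add_smul]
    abel
  rw [e] at hx
  obtain ⟨h₁, h₂, h₃⟩ := H.dvd_of_mem_maximalIdeal_smul HA hp ha hb hx
  intro i
  rw [hr i, HA.mem_maximalIdeal_iff hp]
  fin_cases i
  · exact h₃
  · exact (dvd_add_right (hb.mul_left _)).1 h₁
  · exact (dvd_add_right (ha.mul_left _)).1 h₂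

theorem not_free_of_dvd (HA : IsMonomialOrder ι Φ₁ Φ₂ Φ₃ k)
    (H : IsMonomialModule ι Φ₁ Φ₂ Φ₃ E₀ E₁ E₂ E₃ a b c d) (hp : Irreducible p)
    (ha : p ∣ a) (hb : p ∣ b) : ¬ Module.Free A M := by
  intro hfree
  have B := Module.Free.chooseBasis A M
  have hI := H.subsingleton_of_basis HA B
  have h1 := B.mk_eq_spanRank
  rw [H.spanRank_of_dvd HA hp ha hb] at h1
  have h2 := Cardinal.le_one_iff_subsingleton.2 (Set.subsingleton_coe _ |>.2
    (Set.subsingleton_range (fun i => B i)))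
  rw [h1] at h2
  norm_num at h2

end IsMonomialModule

/-! ### The normalized order of vanishing -/

/-- The normalized additive valuation of the fraction field `F` of a discrete valuation ring `S`,
with the junk value `ord S 0 = 0`. -/
noncomputable def ord (S : Type*) {F : Type*} [CommRing S] [IsDomain S]
    [IsDiscreteValuationRing S] [Field F] [Algebra S F] [IsFractionRing S F] (x : F) : ℤ :=
  -WithZero.log ((IsDiscreteValuationRing.maximalIdeal S).valuation F x)

section Ord

variable {S F : Type*} [CommRing S] [IsDomain S] [IsDiscreteValuationRing S] [Field F] [Algebra S F]
  [IsFractionRing S F]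

theorem ord_mul {x y : F} (hx : x ≠ 0) (hy : y ≠ 0) : ord S (x * y) = ord S x + ord S y := by
  rw [ord, map_mul, WithZero.log_mul ((Valuation.ne_zero_iff _).2 hx)
    ((Valuation.ne_zero_iff _).2 hy), ord, ord]
  ring

@[simp]
theorem ord_one : ord S (1 : F) = 0 := by simp [ord]

theorem ord_zpow (x : F) (n : ℤ) : ord S (x ^ n) = n * ord S x := by
  simp [ord, WithZero.log_zpow]

theorem ord_algebraMap_of_isUnit {u : S} (hu : IsUnit u) : ord S (algebraMap S F u) = 0 := by
  have : (IsDiscreteValuationRing.maximalIdeal S).valuation F (algebraMap S F u) = 1 := by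
    rw [IsDedekindDomain.HeightOneSpectrum.valuation_eq_one_iff_notMem]
    exact fun h => (IsLocalRing.mem_maximalIdeal u).1 h hu
  rw [ord, this, WithZero.log_one, neg_zero]

theorem ord_algebraMap_irreducible {p : S} (hp : Irreducible p) :
    ord S (algebraMap S F p) = 1 := by
  rw [ord, IsDedekindDomain.HeightOneSpectrum.valuation_of_algebraMap,
    IsDedekindDomain.HeightOneSpectrum.intValuation_singleton _ hp.ne_zero hp.maximalIdeal_eq,
    WithZero.log_exp, neg_neg]

theorem exists_isUnit_mul_zpow {p : S} (hp : Irreducible p) {x : F} (hx : x ≠ 0) :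
    ∃ u : S, IsUnit u ∧ x = algebraMap S F u * algebraMap S F p ^ ord S x := by
  obtain ⟨n, u, hu⟩ := IsDiscreteValuationRing.exists_units_eq_smul_zpow_of_irreducible hp hx
  rw [Units.smul_def, Algebra.smul_def] at hu
  have hp0 : algebraMap S F p ≠ 0 := by simpa using hp.ne_zero
  have hn : ord S x = n := by
    rw [hu, ord_mul (by simp) (zpow_ne_zero _ hp0), ord_algebraMap_of_isUnit u.isUnit, ord_zpow,
      ord_algebraMap_irreducible hp]
    ring
  exact ⟨u, u.isUnit, by rw [hn]; exact hu⟩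

theorem ord_algebraMap_nonneg {s : S} (hs : s ≠ 0) : 0 ≤ ord S (algebraMap S F s) := by
  obtain ⟨p, hp⟩ := IsDiscreteValuationRing.exists_irreducible S
  obtain ⟨n, u, rfl⟩ := IsDiscreteValuationRing.eq_unit_mul_pow_irreducible hs hp
  have hp0 : algebraMap S F p ≠ 0 := by simpa using hp.ne_zero
  rw [map_mul, map_pow, ← zpow_natCast, ord_mul (by simp) (zpow_ne_zero _ hp0), ord_zpow,
    ord_algebraMap_of_isUnit u.isUnit, ord_algebraMap_irreducible hp]
  lia

theorem exists_algebraMap_eq {x : F} (hx : 0 ≤ ord S x) : ∃ s : S, algebraMap S F s = x := by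
  by_cases h0 : x = 0
  · exact ⟨0, by rw [h0, map_zero]⟩
  obtain ⟨p, hp⟩ := IsDiscreteValuationRing.exists_irreducible S
  obtain ⟨u, -, hu⟩ := exists_isUnit_mul_zpow hp h0
  lift ord S x to ℕ using hx with n
  exact ⟨u * p ^ n, by rw [hu, map_mul, map_pow, zpow_natCast]⟩

theorem mem_primePow_iff {h : ℤ} {x : F} : x ∈ primePow S F h ↔ x = 0 ∨ h ≤ ord S x := by
  obtain ⟨p, hp⟩ := IsDiscreteValuationRing.exists_irreducible S
  have hp0 : algebraMap S F p ≠ 0 := by simpa using hp.ne_zero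
  have h1 : ((IsLocalRing.maximalIdeal S : FractionalIdeal S⁰ F) ^ h) =
      FractionalIdeal.spanSingleton S⁰ (algebraMap S F p ^ h) := by
    rw [hp.maximalIdeal_eq, FractionalIdeal.coeIdeal_span_singleton]
    cases h with
    | ofNat n => simp [FractionalIdeal.spanSingleton_pow]
    | negSucc n =>
      rw [zpow_negSucc, zpow_negSucc, FractionalIdeal.spanSingleton_pow,
        FractionalIdeal.spanSingleton_inv]
  rw [primePow, h1, FractionalIdeal.mem_coe, FractionalIdeal.mem_spanSingleton]
  constructor
  · rintro ⟨s, rfl⟩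
    by_cases hs : s = 0
    · simp [hs]
    · right
      rw [Algebra.smul_def, ord_mul (by simpa using hs) (zpow_ne_zero _ hp0), ord_zpow,
        ord_algebraMap_irreducible hp]
      linarith [ord_algebraMap_nonneg (F := F) hs]
  · rintro (rfl | hx)
    · exact ⟨0, zero_smul _ _⟩
    · by_cases hx0 : x = 0
      · exact ⟨0, by simp [hx0]⟩
      obtain ⟨s, hs⟩ := exists_algebraMap_eq (S := S) (x := x * algebraMap S F p ^ (-h)) (by
        rw [ord_mul hx0 (zpow_ne_zero _ hp0), ord_zpow, ord_algebraMap_irreducible hp]; linarith)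
      exact ⟨s, by rw [Algebra.smul_def, hs, mul_assoc, ← zpow_add₀ hp0]; simp⟩

theorem le_ord_add {h : ℤ} {x y : F} (hx : h ≤ ord S x) (hy : h ≤ ord S y) (hxy : x + y ≠ 0) :
    h ≤ ord S (x + y) :=
  (mem_primePow_iff.1 (add_mem (mem_primePow_iff.2 (Or.inr hx))
    (mem_primePow_iff.2 (Or.inr hy)))).resolve_left hxy

theorem ord_neg (x : F) : ord S (-x) = ord S x := by
  simp [ord, Valuation.map_neg]

theorem ord_add_of_lt {x y : F} (hx : x ≠ 0) (hxy : ord S x < ord S y) :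
    ord S (x + y) = ord S x ∧ x + y ≠ 0 := by
  have h0 : x + y ≠ 0 := fun h => by
    rw [eq_neg_of_add_eq_zero_left h, ord_neg] at hxy
    exact lt_irrefl _ hxy
  refine ⟨le_antisymm ?_ (le_ord_add le_rfl hxy.le h0), h0⟩
  by_contra! hlt
  have h2 := le_ord_add (S := S) (h := ord S x + 1) (x := x + y) (y := -y) hlt
    (by rw [ord_neg]; exact hxy) (by simpa using hx)
  rw [add_neg_cancel_right] at h2
  linarith

/-- A sum of terms of distinct orders lies in `𝔓 ^ h` only if every term does. -/
theorem mem_primePow_of_sum_mem {ι : Type*} [Fintype ι] {y : ι → F}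
    (hy : ∀ i j, y i ≠ 0 → y j ≠ 0 → ord S (y i) = ord S (y j) → i = j) {h : ℤ}
    (hsum : ∑ i, y i ∈ primePow S F h) (i : ι) : y i ∈ primePow S F h := by
  classical
  by_contra hi
  obtain ⟨j, hj, hmin⟩ := Finset.exists_min_image
    (Finset.univ.filter fun j => y j ∉ primePow S F h) (fun j => ord S (y j)) ⟨i, by simp [hi]⟩
  simp only [Finset.mem_filter, Finset.mem_univ, true_and] at hj hmin
  have hj' := hj
  rw [mem_primePow_iff] at hj'
  push Not at hj'
  have hrest : ∑ l ∈ Finset.univ.erase j, y l ∈ primePow S F (ord S (y j) + 1) := by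
    refine sum_mem fun l hl => ?_
    have hlj := Finset.ne_of_mem_erase hl
    rw [mem_primePow_iff]
    by_cases hl0 : y l = 0
    · exact Or.inl hl0
    right
    by_cases hlh : y l ∈ primePow S F h
    · have := (mem_primePow_iff.1 hlh).resolve_left hl0
      linarith
    · have h1 := hmin l hlh
      have h2 : ord S (y j) ≠ ord S (y l) := fun h => hlj (hy j l hj'.1 hl0 h).symm
      lia
  have hsum' : ∑ i, y i ∈ primePow S F (ord S (y j) + 1) := by
    rw [mem_primePow_iff] at hsum ⊢
    exact hsum.imp_right fun h => by linarith
  rw [← Finset.add_sum_erase _ _ (Finset.mem_univ j)] at hsum'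
  have h3 := (mem_primePow_iff.1 ((add_mem_cancel_right hrest).1 hsum')).resolve_left hj'.1
  linarith

theorem eq_zero_of_sum_eq_zero {ι : Type*} [Fintype ι] {y : ι → F}
    (hy : ∀ i j, y i ≠ 0 → y j ≠ 0 → ord S (y i) = ord S (y j) → i = j)
    (hsum : ∑ i, y i = 0) (i : ι) : y i = 0 := by
  have h1 := mem_primePow_of_sum_mem (S := S) hy (h := ord S (y i) + 1)
    (by rw [hsum]; exact zero_mem _) i
  rcases mem_primePow_iff.1 h1 with h | h
  · exact h
  · linarith

end Ord

/-! ### Totally ramified extensions of degree four -/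

section Galois

variable {R S K L : Type*} [CommRing R] [CommRing S] [IsDomain S] [IsDiscreteValuationRing S]
  [Field K] [Field L] [Algebra R K] [Algebra K L] [Algebra R L] [Algebra S L] [IsScalarTower R K L]
  [IsFractionRing S L]

theorem ord_galois [IsIntegralClosure S R L] (σ : Gal(L/K)) (x : L) :
    ord S (σ x) = ord S x := by
  -- It is enough to prove one inequality on `S`, for every automorphism.
  have hS : ∀ (τ : Gal(L/K)) (s : S), ∃ t : S, algebraMap S L t = τ (algebraMap S L s) :=
    fun τ s => (IsIntegralClosure.isIntegral_iff (A := S) (R := R)).1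
      (((IsIntegralClosure.isIntegral_iff (A := S) (R := R)).2 ⟨s, rfl⟩).map
        (τ.toAlgHom.restrictScalars R))
  have hunit : ∀ (τ : Gal(L/K)) (s : S), IsUnit s → ord S (τ (algebraMap S L s)) = 0 := by
    intro τ s hs
    obtain ⟨t, ht⟩ := hS τ s
    obtain ⟨s', hs'⟩ := hs.exists_right_inv
    obtain ⟨t', ht'⟩ := hS τ s'
    rw [← ht]
    refine ord_algebraMap_of_isUnit (IsUnit.of_mul_eq_one t' ?_)
    apply FaithfulSMul.algebraMap_injective S L
    rw [map_mul, ht, ht', ← map_mul, ← map_mul, hs', map_one, map_one]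
  obtain ⟨p, hp⟩ := IsDiscreteValuationRing.exists_irreducible S
  have hp0 : algebraMap S L p ≠ 0 := by simpa using hp.ne_zero
  have hτ : ∀ (τ : Gal(L/K)) (y : L), ord S (τ y) = ord S y * ord S (τ (algebraMap S L p)) := by
    intro τ y
    by_cases hy : y = 0
    · simp [hy, ord]
    obtain ⟨u, hu, hy'⟩ := exists_isUnit_mul_zpow hp hy
    conv_lhs => rw [hy', map_mul, map_zpow₀]
    have hu0 : τ (algebraMap S L u) ≠ 0 := by simpa using hu.ne_zero
    rw [ord_mul hu0 (zpow_ne_zero _ (by simpa using hp0)), hunit τ u hu, ord_zpow, zero_add]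
  have hpos : ∀ τ : Gal(L/K), 0 ≤ ord S (τ (algebraMap S L p)) := fun τ => by
    obtain ⟨t, ht⟩ := hS τ p
    rw [← ht]
    refine ord_algebraMap_nonneg ?_
    rintro rfl
    rw [map_zero, eq_comm, map_eq_zero] at ht
    exact hp0 ht
  have h1 := hτ σ⁻¹ (σ (algebraMap S L p))
  have h2 : σ⁻¹ (σ (algebraMap S L p)) = algebraMap S L p := AlgEquiv.symm_apply_apply σ _
  rw [h2, ord_algebraMap_irreducible hp] at h1
  have h3 : ord S (σ (algebraMap S L p)) = 1 := by
    have := Int.eq_one_or_neg_one_of_mul_eq_one h1.symm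
    have := hpos σ
    lia
  rw [hτ σ x, h3, mul_one]

end Galois

section Ramified

variable {R S K L : Type*} [CommRing R] [IsDomain R] [IsDiscreteValuationRing R] [CommRing S]
  [IsDomain S] [IsDiscreteValuationRing S] [Field K] [Field L] [Algebra R K] [IsFractionRing R K]
  [Algebra K L] [Algebra R L] [Algebra S L] [IsScalarTower R K L] [IsFractionRing S L]
  [Algebra R S] [IsScalarTower R S L]

/-- The ramification index of `L/K` is `4`, in terms of the normalized valuations. -/
theorem ord_algebraMap_of_ramified
    (hram : (IsLocalRing.maximalIdeal R).map (algebraMap R S) = IsLocalRing.maximalIdeal S ^ 4)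
    {x : K} (hx : x ≠ 0) : ord S (algebraMap K L x) = 4 * ord R x := by
  obtain ⟨p, hp⟩ := IsDiscreteValuationRing.exists_irreducible R
  obtain ⟨q, hq⟩ := IsDiscreteValuationRing.exists_irreducible S
  have hp0 : algebraMap R K p ≠ 0 := by simpa using hp.ne_zero
  have hq0 : algebraMap S L q ≠ 0 := by simpa using hq.ne_zero
  have tower : ∀ r : R, algebraMap K L (algebraMap R K r) = algebraMap S L (algebraMap R S r) :=
    fun r => by rw [← IsScalarTower.algebraMap_apply, ← IsScalarTower.algebraMap_apply]
  rw [hp.maximalIdeal_eq, hq.maximalIdeal_eq, Ideal.map_span, Set.image_singleton,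
    Ideal.span_singleton_pow, Ideal.span_singleton_eq_span_singleton] at hram
  obtain ⟨v, hv⟩ := hram
  have h4 : ord S (algebraMap K L (algebraMap R K p)) = 4 := by
    have h1 := ord_mul (S := S) (x := algebraMap K L (algebraMap R K p))
      (y := algebraMap S L (v : S)) (by simpa using hp0) (by simp)
    rw [ord_algebraMap_of_isUnit v.isUnit, add_zero] at h1
    rw [← h1, tower, ← map_mul, hv, map_pow, ← zpow_natCast, ord_zpow,
      ord_algebraMap_irreducible hq]
    norm_num
  obtain ⟨u, hu, hx'⟩ := exists_isUnit_mul_zpow hp hx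
  conv_lhs => rw [hx', map_mul, map_zpow₀]
  have hu0 : algebraMap K L (algebraMap R K u) ≠ 0 := by simpa using hu.ne_zero
  rw [ord_mul hu0 (zpow_ne_zero _ (by simpa using hp0)), ord_zpow, h4, tower,
    ord_algebraMap_of_isUnit (hu.map _)]
  ring

end Ramified

section OrdBasis

variable {R S K L : Type*} [CommRing R] [IsDomain R] [IsDiscreteValuationRing R] [CommRing S]
  [IsDomain S] [IsDiscreteValuationRing S] [Field K] [Field L] [Algebra R K] [IsFractionRing R K]
  [Algebra K L] [Algebra S L] [IsFractionRing S L] {e : Fin 4 → L}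

theorem ord_smul_distinct (hK : ∀ x : K, x ≠ 0 → ord S (algebraMap K L x) = 4 * ord R x)
    (he0 : ∀ i, e i ≠ 0) (he : ∀ i j, ord S (e i) ≡ ord S (e j) [ZMOD 4] → i = j) (c : Fin 4 → K)
    (i j : Fin 4) (hi : c i • e i ≠ 0) (hj : c j • e j ≠ 0)
    (h : ord S (c i • e i) = ord S (c j • e j)) : i = j := by
  have hc : ∀ i, c i • e i ≠ 0 → c i ≠ 0 := fun i hi => left_ne_zero_of_smul hi
  rw [Algebra.smul_def, Algebra.smul_def, ord_mul (by simpa using hc i hi) (he0 i),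
    ord_mul (by simpa using hc j hj) (he0 j), hK _ (hc i hi), hK _ (hc j hj)] at h
  refine he i j ?_
  rw [Int.ModEq]
  lia

/-- Four elements whose orders are incongruent modulo `4` form a `K`-basis of `L`. -/
noncomputable def ordBasis (hdim : Module.finrank K L = 4)
    (hK : ∀ x : K, x ≠ 0 → ord S (algebraMap K L x) = 4 * ord R x)
    (he0 : ∀ i, e i ≠ 0) (he : ∀ i j, ord S (e i) ≡ ord S (e j) [ZMOD 4] → i = j) :
    Module.Basis (Fin 4) K L :=
  basisOfLinearIndependentOfCardEqFinrank (b := e) (by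
    rw [Fintype.linearIndependent_iff]
    intro c hc i
    exact (smul_eq_zero_iff_left (he0 i)).1
      (eq_zero_of_sum_eq_zero (S := S) (ord_smul_distinct hK he0 he c) hc i)) (by simp [hdim])

theorem exists_coord_of_ord (hdim : Module.finrank K L = 4)
    (hK : ∀ x : K, x ≠ 0 → ord S (algebraMap K L x) = 4 * ord R x)
    (he0 : ∀ i, e i ≠ 0) (he : ∀ i j, ord S (e i) ≡ ord S (e j) [ZMOD 4] → i = j) (x : L) :
    ∃ c : Fin 4 → K, x = ∑ i, c i • e i := by
  refine ⟨(ordBasis hdim hK he0 he).repr x, ?_⟩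
  conv_lhs => rw [← (ordBasis hdim hK he0 he).sum_repr x]
  simp [ordBasis]

/-- A totally ramified extension has trivial residue extension: the class of an element of `S`
modulo `𝔓` is represented in `K`. -/
theorem exists_approx (hdim : Module.finrank K L = 4)
    (hK : ∀ x : K, x ≠ 0 → ord S (algebraMap K L x) = 4 * ord R x) {x : L} (hx : 0 ≤ ord S x) :
    ∃ c : K, x - algebraMap K L c ∈ primePow S L 1 := by
  obtain ⟨q, hq⟩ := IsDiscreteValuationRing.exists_irreducible S
  have hq0 : algebraMap S L q ≠ 0 := by simpa using hq.ne_zero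
  let e : Fin 4 → L := fun i => algebraMap S L q ^ (i : ℤ)
  have he0 : ∀ i, e i ≠ 0 := fun i => zpow_ne_zero _ hq0
  have hord : ∀ i, ord S (e i) = i := fun i => by
    rw [ord_zpow, ord_algebraMap_irreducible hq, mul_one]
  have he : ∀ i j, ord S (e i) ≡ ord S (e j) [ZMOD 4] → i = j := fun i j h => by
    rw [hord, hord, Int.ModEq] at h
    omega
  obtain ⟨c, hc⟩ := exists_coord_of_ord hdim hK he0 he x
  have hmem := mem_primePow_of_sum_mem (S := S) (ord_smul_distinct hK he0 he c) (h := 0)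
    (by rw [← hc]; exact mem_primePow_iff.2 (Or.inr hx))
  refine ⟨c 0, ?_⟩
  have h0 : c 0 • e 0 = algebraMap K L (c 0) := by simp [e, Algebra.smul_def]
  rw [hc, Fin.sum_univ_succ, h0, add_sub_cancel_left]
  refine sum_mem fun i _ => ?_
  rw [mem_primePow_iff]
  by_cases hi : c i.succ • e i.succ = 0
  · exact Or.inl hi
  right
  have h1 := (mem_primePow_iff.1 (hmem i.succ)).resolve_left hi
  have hci : c i.succ ≠ 0 := left_ne_zero_of_smul hi
  rw [Algebra.smul_def, ord_mul (by simpa using hci) (he0 _), hK _ hci, hord] at h1 ⊢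
  have : ((i.succ : Fin 4) : ℤ) = i + 1 := by simp
  omega

/-- An element whose order is congruent modulo `4` to that of `z` can be moved to a larger order by
subtracting a `K`-multiple of `z`. -/
theorem exists_ord_sub_gt (hdim : Module.finrank K L = 4)
    (hK : ∀ x : K, x ≠ 0 → ord S (algebraMap K L x) = 4 * ord R x) {x z : L} (hx : x ≠ 0)
    (hz : z ≠ 0) (h : ord S x ≡ ord S z [ZMOD 4]) :
    ∃ c : K, x - algebraMap K L c * z ∈ primePow S L (ord S x + 1) := by
  obtain ⟨p, hp⟩ := IsDiscreteValuationRing.exists_irreducible R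
  have hp0 : algebraMap R K p ≠ 0 := by simpa using hp.ne_zero
  obtain ⟨m, hm⟩ := h.symm.dvd
  set w : K := algebraMap R K p ^ m with hw
  have hw0 : w ≠ 0 := zpow_ne_zero _ hp0
  have hwL : algebraMap K L w ≠ 0 := by simpa using hw0
  have how : ord S (algebraMap K L w) = 4 * m := by
    rw [hK w hw0, hw, ord_zpow, ord_algebraMap_irreducible hp, mul_one]
  have hwz : algebraMap K L w * z ≠ 0 := mul_ne_zero hwL hz
  have howz : ord S (algebraMap K L w * z) = ord S x := by rw [ord_mul hwL hz, how]; lia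
  set u := x / (algebraMap K L w * z) with hu
  have hxu : x = u * (algebraMap K L w * z) := by rw [hu, div_mul_cancel₀ _ hwz]
  have hu0 : u ≠ 0 := div_ne_zero hx hwz
  have hou : ord S u = 0 := by
    have := ord_mul (S := S) hu0 hwz
    rw [← hxu, howz] at this
    linarith
  obtain ⟨c, hc⟩ := exists_approx hdim hK hou.ge
  refine ⟨c * w, ?_⟩
  have e : x - algebraMap K L (c * w) * z =
      (u - algebraMap K L c) * (algebraMap K L w * z) := by
    rw [map_mul]; linear_combination hxu
  rw [e]
  rw [mem_primePow_iff] at hc ⊢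
  by_cases h0 : u - algebraMap K L c = 0
  · left; rw [h0, zero_mul]
  · right
    rw [ord_mul h0 hwz, howz]
    linarith [hc.resolve_left h0]

end OrdBasis

/-! ### Artin–Schreier generators of optimal order -/

theorem IsKleinFour.eq_one_or_eq {G : Type*} [Group G] [IsKleinFour G] {a b : G} (ha : a ≠ 1)
    (hb : b ≠ 1) (hab : a ≠ b) (g : G) : g = 1 ∨ g = a ∨ g = b ∨ g = a * b := by
  by_cases h1 : g = 1
  · exact Or.inl h1
  by_cases h2 : g = a
  · exact Or.inr (Or.inl h2)
  by_cases h3 : g = b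
  · exact Or.inr (Or.inr (Or.inl h3))
  exact Or.inr (Or.inr (Or.inr (IsKleinFour.eq_mul_of_ne_all ha hb hab h1 h2 h3)))

theorem two_eq_zero_of_algebra (K L : Type*) [Field K] [CharP K 2] [Field L] [Algebra K L] :
    (2 : L) = 0 :=
  have := charP_of_injective_algebraMap (algebraMap K L).injective 2
  CharTwo.two_eq_zero

section ArtinSchreier

variable {K L : Type*} [Field K] [CharP K 2] [Field L] [Algebra K L] [FiniteDimensional K L]
  [IsGalois K L] [IsKleinFour Gal(L/K)]

/-- Additive Hilbert 90 for the character of `C₂ × C₂` that is nontrivial on `σ₁` and trivial on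
`σ₂`. -/
theorem exists_artinSchreier {σ₁ σ₂ : Gal(L/K)} (h₁ : σ₁ ≠ 1) (h₂ : σ₂ ≠ 1) (h₁₂ : σ₁ ≠ σ₂) :
    ∃ x : L, σ₁ x = x + 1 ∧ σ₂ x = x := by
  classical
  have two := two_eq_zero_of_algebra K L
  obtain ⟨θ, hθ⟩ := Algebra.trace_surjective K L 1
  have htr := trace_eq_sum_automorphisms (K := K) θ
  have hsum := IsKleinFour.eq_finset_univ h₁ h₂ h₁₂
  have hne : σ₁ * σ₂ ∉ ({σ₁, σ₂, 1} : Finset Gal(L/K)) := by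
    simpa using mul_notMem_of_exponent_two (IsKleinFour.exponent_two) h₁ h₂ h₁₂
  rw [hθ, map_one, ← hsum, Finset.sum_insert hne, Finset.sum_insert (by simp [h₁₂, h₁]),
    Finset.sum_insert (by simp [h₂]), Finset.sum_singleton] at htr
  have sq : ∀ (τ : Gal(L/K)) (z : L), τ (τ z) = z := fun τ z => by
    rw [← AlgEquiv.mul_apply, IsKleinFour.mul_self, AlgEquiv.one_apply]
  have comm : σ₂ * σ₁ = σ₁ * σ₂ :=
    (IsKleinFour.isMulCommutative (G := Gal(L/K))).is_comm.comm σ₂ σ₁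
  have comm' : ∀ z, σ₂ (σ₁ z) = σ₁ (σ₂ z) := fun z => by
    rw [← AlgEquiv.mul_apply, comm, AlgEquiv.mul_apply]
  simp only [AlgEquiv.mul_apply, AlgEquiv.one_apply] at htr
  refine ⟨σ₁ θ + σ₁ (σ₂ θ), ?_, ?_⟩
  · rw [map_add, sq, sq]
    linear_combination -htr - (σ₁ θ + σ₁ (σ₂ θ)) * two
  · rw [map_add, comm' θ, comm' (σ₂ θ), sq, add_comm]

/-- `x` generates a quadratic Artin–Schreier subextension: it is not in `K`, and every automorphism
either fixes it or adds `1` to it. -/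
def IsArtinSchreierGenerator (K : Type*) {L : Type*} [Field K] [Field L] [Algebra K L] (x : L) :
    Prop :=
  x ∉ Set.range (algebraMap K L) ∧ ∀ σ : Gal(L/K), σ x = x ∨ σ x = x + 1

omit [CharP K 2] [IsKleinFour Gal(L/K)] in
theorem IsArtinSchreierGenerator.exists_galois {x : L} (hx : IsArtinSchreierGenerator K x) :
    ∃ σ : Gal(L/K), σ x = x + 1 := by
  by_contra! h
  exact hx.1 ((IsGalois.mem_range_algebraMap_iff_fixed x).2
    fun σ => (hx.2 σ).resolve_right (h σ))

omit [CharP K 2] [FiniteDimensional K L] [IsGalois K L] in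
theorem isArtinSchreierGenerator_of_apply {x : L} {σ₁ σ₂ : Gal(L/K)}
    (h₁ : σ₁ ≠ 1) (h₂ : σ₂ ≠ 1) (h₁₂ : σ₁ ≠ σ₂)
    (hx₁ : σ₁ x = x ∨ σ₁ x = x + 1) (hx₂ : σ₂ x = x + 1) (two : (2 : L) = 0) :
    IsArtinSchreierGenerator K x := by
  refine ⟨?_, fun τ => ?_⟩
  · rintro ⟨c, rfl⟩
    rw [AlgEquiv.commutes] at hx₂
    exact one_ne_zero (left_eq_add.1 hx₂)
  · rcases IsKleinFour.eq_one_or_eq h₁ h₂ h₁₂ τ with rfl | rfl | rfl | rfl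
    · exact Or.inl rfl
    · exact hx₁
    · exact Or.inr hx₂
    · rw [AlgEquiv.mul_apply, hx₂, map_add, map_one]
      rcases hx₁ with h | h
      · exact Or.inr (by rw [h])
      · exact Or.inl (by rw [h]; linear_combination two)

end ArtinSchreier

/-! ### The Galois scaffold -/

section Scaffold

variable {R S K L : Type*} [CommRing R] [IsDomain R] [IsDiscreteValuationRing R] [CommRing S]
  [IsDomain S] [IsDiscreteValuationRing S] [Field K] [Field L] [Algebra R K] [IsFractionRing R K]
  [Algebra K L] [Algebra S L] [IsFractionRing S L]

/-- A Galois scaffold for a biquadratic extension: the elements `1, x, y, x y` have orders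
`0, -2 c₁, -c₂, -2 c₁ - c₂`, which are incongruent modulo `4`, while `σ₂ - 1` and
`σ₁ (1 + μ (σ₂ - 1)) - 1` act on them as differentiation with respect to `y` and `x`. -/
structure IsScaffold (S : Type*) {K L : Type*} [CommRing S] [IsDomain S]
    [IsDiscreteValuationRing S] [Field K] [Field L] [Algebra K L] [Algebra S L] [IsFractionRing S L]
    (σ₁ σ₂ : Gal(L/K)) (x y : L) (μ : K) (c₁ c₂ : ℤ) : Prop where
  gal_cases : ∀ τ : Gal(L/K), τ = 1 ∨ τ = σ₁ ∨ τ = σ₂ ∨ τ = σ₁ * σ₂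
  apply₁x : σ₁ x = x + 1
  apply₂x : σ₂ x = x
  apply₁y : σ₁ y = y + algebraMap K L μ
  apply₂y : σ₂ y = y + 1
  ord_x : ord S x = -(2 * c₁)
  ord_y : ord S y = -c₂
  odd : c₁ % 2 = 1
  pos : 0 < c₁
  le : c₁ ≤ c₂
  mod_four : c₁ ≡ c₂ [ZMOD 4]
  μ_ne_zero : μ ≠ 0
  μ_add_one_ne_zero : μ + 1 ≠ 0
  ord_μ : ord S (algebraMap K L μ) = c₁ - c₂
  ord_μ_add_one : ord S (algebraMap K L (μ + 1)) = c₁ - c₂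

omit [Algebra R K] [IsFractionRing R K] [CommRing R] [IsDomain R] [IsDiscreteValuationRing R] in
theorem ord_nonpos_of_apply_eq_add_one (hG : ∀ (σ : Gal(L/K)) (x : L), ord S (σ x) = ord S x)
    {σ : Gal(L/K)} {x : L} (hx : σ x = x + 1) : ord S x ≤ 0 := by
  by_contra! h
  have h1 : σ x - x ∈ primePow S L 1 := sub_mem
    (mem_primePow_iff.2 (Or.inr (by rw [hG]; exact h))) (mem_primePow_iff.2 (Or.inr h))
  rw [hx, add_sub_cancel_left, mem_primePow_iff, ord_one] at h1
  simp at h1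

/-- A nonempty set of elements of bounded order has an element of greatest order. -/
theorem exists_ord_max {T : Set L} (hne : T.Nonempty) {b : ℤ} (hb : ∀ x ∈ T, ord S x ≤ b) :
    ∃ x ∈ T, ∀ z ∈ T, ord S z ≤ ord S x := by
  obtain ⟨n, ⟨x, hx, rfl⟩, hn⟩ := Int.exists_greatest_of_bdd
    (P := fun n => ∃ x ∈ T, ord S x = n) ⟨b, by rintro _ ⟨x, hx, rfl⟩; exact hb x hx⟩
    (let ⟨x, hx⟩ := hne; ⟨_, x, hx, rfl⟩)
  exact ⟨x, hx, fun z hz => hn _ ⟨z, hz, rfl⟩⟩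

/-- An element of greatest order in a set stable under subtracting `K`-multiples of `z` has order
incongruent to that of `z`. -/
theorem not_modEq_of_ord_max (hdim : Module.finrank K L = 4)
    (hK : ∀ x : K, x ≠ 0 → ord S (algebraMap K L x) = 4 * ord R x) {T : Set L} (h0 : (0 : L) ∉ T)
    {x z : L} (hx : x ∈ T) (hmax : ∀ w ∈ T, ord S w ≤ ord S x) (hz : z ≠ 0)
    (hT : ∀ c : K, x - algebraMap K L c * z ∈ T) : ¬ ord S x ≡ ord S z [ZMOD 4] := by
  intro h
  obtain ⟨c, hc⟩ := exists_ord_sub_gt hdim hK (fun hx0 => h0 (hx0 ▸ hx)) hz h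
  have h1 := (mem_primePow_iff.1 hc).resolve_left (fun h2 => h0 (h2 ▸ hT c))
  linarith [hmax _ (hT c)]

variable [CharP K 2] [FiniteDimensional K L] [IsGalois K L] [IsKleinFour Gal(L/K)]

/-- Choose `x` of greatest order among all Artin–Schreier generators, and `y` of greatest order
among the elements with `(σ₂ - 1) y = 1` and `(σ₁ - 1) y ∈ K`. Since residue classes are represented
in `K`, maximality forces the orders of `1, x, y, x y` to be incongruent modulo `4`. -/
theorem exists_isScaffold (hdim : Module.finrank K L = 4)
    (hK : ∀ x : K, x ≠ 0 → ord S (algebraMap K L x) = 4 * ord R x)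
    (hG : ∀ (σ : Gal(L/K)) (x : L), ord S (σ x) = ord S x) :
    ∃ (σ₁ σ₂ : Gal(L/K)) (x y : L) (μ : K) (c₁ c₂ : ℤ), IsScaffold S σ₁ σ₂ x y μ c₁ c₂ := by
  classical
  have two := two_eq_zero_of_algebra K L
  have sq : ∀ (τ : Gal(L/K)), τ * τ = 1 := IsKleinFour.mul_self
  -- The generator `x` of greatest order.
  have hne : {x : L | IsArtinSchreierGenerator K x}.Nonempty := by
    have h4 : 2 < Nat.card Gal(L/K) := by rw [IsKleinFour.card_four]; norm_num
    have := Nat.finite_of_card_ne_zero (α := Gal(L/K)) (by lia)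
    let _ := Fintype.ofFinite Gal(L/K)
    rw [Nat.card_eq_fintype_card] at h4
    obtain ⟨a, b, c, hab, hac, hbc⟩ := Fintype.two_lt_card_iff.1 h4
    obtain ⟨τ₁, τ₂, h₁, h₂, h₁₂⟩ : ∃ τ₁ τ₂ : Gal(L/K), τ₁ ≠ 1 ∧ τ₂ ≠ 1 ∧ τ₁ ≠ τ₂ := by
      by_cases ha : a = 1
      · exact ⟨b, c, ha ▸ hab.symm, ha ▸ hac.symm, hbc⟩
      by_cases hb : b = 1
      · exact ⟨a, c, ha, hb ▸ hbc.symm, hac⟩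
      exact ⟨a, b, ha, hb, hab⟩
    obtain ⟨x, hx₂, hx₁⟩ := exists_artinSchreier h₂ h₁ h₁₂.symm
    exact ⟨x, isArtinSchreierGenerator_of_apply h₁ h₂ h₁₂ (Or.inl hx₁) hx₂ two⟩
  obtain ⟨x, hx, hxmax⟩ := exists_ord_max (S := S) (b := 0) hne
    fun z (hz : IsArtinSchreierGenerator K z) =>
      ord_nonpos_of_apply_eq_add_one hG hz.exists_galois.choose_spec
  have hx' : IsArtinSchreierGenerator K x := hx
  have hsub : ∀ c : K, IsArtinSchreierGenerator K (x - algebraMap K L c) := by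
    refine fun c => ⟨?_, fun σ => ?_⟩
    · rintro ⟨d, hd⟩
      exact hx'.1 ⟨d + c, by rw [map_add, hd, sub_add_cancel]⟩
    · rw [map_sub, AlgEquiv.commutes]
      exact (hx'.2 σ).imp (fun h => by rw [h]) (fun h => by rw [h]; ring)
  have hxmod := not_modEq_of_ord_max hdim hK (z := 1)
    (T := {x : L | IsArtinSchreierGenerator K x}) (fun h => h.1 ⟨0, map_zero _⟩) hx hxmax
    one_ne_zero (fun c => by simpa using hsub c)
  rw [ord_one] at hxmod
  obtain ⟨σ₁, hσ₁x⟩ := hx'.exists_galois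
  have hσ₁ : σ₁ ≠ 1 := by
    rintro rfl
    exact one_ne_zero (left_eq_add.1 hσ₁x)
  have hx0 : x ≠ 0 := fun h => hx'.1 ⟨0, by rw [h, map_zero]⟩
  have hxneg : ord S x < 0 := by
    have := ord_nonpos_of_apply_eq_add_one hG hσ₁x
    rcases this.lt_or_eq with h | h
    · exact h
    · exact (hxmod (by rw [h])).elim
  have hx1 : x + 1 ≠ 0 := by rw [← hσ₁x]; simpa using hx0
  have hxord : ord S x % 4 = 2 := by
    obtain ⟨a, ha⟩ := (IsGalois.mem_range_algebraMap_iff_fixed (F := K) (x * (x + 1))).2 (by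
      intro σ
      rw [map_mul, map_add, map_one]
      rcases hx'.2 σ with h | h
      · rw [h]
      · rw [h]; linear_combination (x + 1) * two)
    have ha0 : a ≠ 0 := by
      rintro rfl
      rw [map_zero, eq_comm] at ha
      exact mul_ne_zero hx0 hx1 ha
    have h1 := hK a ha0
    rw [ha, ord_mul hx0 hx1, ← hσ₁x, hG] at h1
    rw [Int.ModEq] at hxmod
    lia
  obtain ⟨σ₂, hσ₂, hσ₂x, hσ₁₂⟩ : ∃ σ₂ : Gal(L/K), σ₂ ≠ 1 ∧ σ₂ x = x ∧ σ₁ ≠ σ₂ := by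
    obtain ⟨τ, hτ⟩ : ∃ τ : Gal(L/K), τ ∉ ({1, σ₁} : Set Gal(L/K)) := by
      by_contra! h
      have h1 : Nat.card Gal(L/K) ≤ 2 := by
        rw [← Set.ncard_univ]
        refine (Set.ncard_le_ncard (fun τ _ => h τ) (Set.toFinite _)).trans ?_
        exact (Set.ncard_insert_le 1 {σ₁}).trans (by rw [Set.ncard_singleton])
      rw [IsKleinFour.card_four] at h1
      lia
    simp only [Set.mem_insert_iff, Set.mem_singleton_iff, not_or] at hτ
    rcases hx'.2 τ with h | h
    · exact ⟨τ, hτ.1, h, Ne.symm hτ.2⟩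
    · refine ⟨σ₁ * τ, fun h1 => hτ.2 ?_, ?_, fun h1 => hτ.1 (left_eq_mul.1 h1)⟩
      · rw [← mul_right_inj σ₁, h1, sq]
      · rw [AlgEquiv.mul_apply, h, map_add, hσ₁x, map_one]
        linear_combination two
  -- The generator `y` of greatest order.
  obtain ⟨x₂, hx₂₂, hx₂₁⟩ := exists_artinSchreier hσ₂ hσ₁ hσ₁₂.symm
  let T : Set L := {y | σ₂ y = y + 1 ∧ ∃ μ : K, σ₁ y = y + algebraMap K L μ}
  obtain ⟨y, hy, hymax⟩ := exists_ord_max (S := S) (T := T) (b := 0)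
    ⟨x₂, hx₂₂, 0, by rw [hx₂₁, map_zero, add_zero]⟩
    (fun z hz => ord_nonpos_of_apply_eq_add_one hG hz.1)
  have hT0 : (0 : L) ∉ T := fun h => by
    have h1 := h.1
    rw [map_zero, zero_add] at h1
    exact zero_ne_one h1
  have hy' := hy
  obtain ⟨hσ₂y, μ, hσ₁y⟩ := hy'
  have hy0 : y ≠ 0 := fun h => hT0 (h ▸ hy)
  have hymod0 := not_modEq_of_ord_max hdim hK hT0 hy hymax (z := 1) one_ne_zero (fun c => by
    refine ⟨?_, μ, ?_⟩
    · rw [mul_one, map_sub, AlgEquiv.commutes, hσ₂y]; ring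
    · rw [mul_one, map_sub, AlgEquiv.commutes, hσ₁y]; ring)
  have hymod2 := not_modEq_of_ord_max hdim hK hT0 hy hymax (z := x) hx0 (fun c => by
    refine ⟨?_, μ - c, ?_⟩
    · rw [map_sub, map_mul, AlgEquiv.commutes, hσ₂y, hσ₂x]; ring
    · rw [map_sub, map_mul, AlgEquiv.commutes, hσ₁y, hσ₁x, map_sub]; ring)
  rw [ord_one] at hymod0
  rw [Int.ModEq] at hymod0 hymod2
  have hyneg : ord S y < 0 := by
    have := ord_nonpos_of_apply_eq_add_one hG hσ₂y
    lia
  -- `y² + y = (μ² + μ) x + a` with `a ∈ K`; comparing orders determines the order of `μ² + μ`.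
  have hy1 : y + 1 ≠ 0 := by rw [← hσ₂y]; simpa using hy0
  have hyord : ord S (y * (y + 1)) = 2 * ord S y := by
    rw [ord_mul hy0 hy1, ← hσ₂y, hG]; ring
  set ν : K := μ * (μ + 1) with hν
  obtain ⟨a, ha⟩ := (IsGalois.mem_range_algebraMap_iff_fixed (F := K)
    (y * (y + 1) - algebraMap K L ν * x)).2 (by
      have e₁ : σ₁ (y * (y + 1) - algebraMap K L ν * x) =
          y * (y + 1) - algebraMap K L ν * x := by
        simp only [map_sub, map_mul, map_add, map_one, AlgEquiv.commutes, hσ₁y, hσ₁x, hν]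
        linear_combination (y * algebraMap K L μ) * two
      have e₂ : σ₂ (y * (y + 1) - algebraMap K L ν * x) =
          y * (y + 1) - algebraMap K L ν * x := by
        simp only [map_sub, map_mul, map_add, map_one, AlgEquiv.commutes, hσ₂y, hσ₂x]
        linear_combination (y + 1) * two
      intro τ
      rcases IsKleinFour.eq_one_or_eq hσ₁ hσ₂ hσ₁₂ τ with rfl | rfl | rfl | rfl
      · rfl
      · exact e₁
      · exact e₂
      · rw [AlgEquiv.mul_apply, e₂, e₁])
  have hae : y * (y + 1) = algebraMap K L a + algebraMap K L ν * x := by rw [ha]; ring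
  have hν0 : ν ≠ 0 := by
    intro h
    rw [h, map_zero, zero_mul, add_zero] at hae
    have ha0 : a ≠ 0 := by
      rintro rfl
      rw [map_zero] at hae
      exact mul_ne_zero hy0 hy1 hae
    have h1 := hK a ha0
    rw [← hae, hyord] at h1
    lia
  have hμ0 : μ ≠ 0 := fun h => hν0 (by rw [hν, h, zero_mul])
  have hμ1 : μ + 1 ≠ 0 := fun h => hν0 (by rw [hν, h, mul_zero])
  have hinj : ∀ {c : K}, c ≠ 0 → algebraMap K L c ≠ 0 := fun {c} hc => by simpa using hc
  have hνx : ord S (algebraMap K L ν * x) = 2 * ord S y := by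
    have hνx0 : algebraMap K L ν * x ≠ 0 := mul_ne_zero (hinj hν0) hx0
    have h2 : ord S (algebraMap K L ν * x) = 4 * ord R ν + ord S x := by
      rw [ord_mul (hinj hν0) hx0, hK ν hν0]
    rw [← hyord, hae]
    by_cases ha0 : a = 0
    · rw [ha0, map_zero, zero_add]
    · have h1 := hK a ha0
      rcases lt_trichotomy (ord S (algebraMap K L a)) (ord S (algebraMap K L ν * x))
        with h | h | h
      · have h3 := (ord_add_of_lt (hinj ha0) h).1
        rw [← hae, hyord] at h3
        lia
      · lia
      · rw [add_comm, (ord_add_of_lt hνx0 h).1]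
  have hνord : ord S (algebraMap K L ν) =
      ord S (algebraMap K L μ) + ord S (algebraMap K L (μ + 1)) := by
    rw [hν, map_mul, ord_mul (hinj hμ0) (hinj hμ1)]
  rw [ord_mul (hinj hν0) hx0, hνord] at hνx
  have hμm := hK μ hμ0
  have hμm1 := hK _ hμ1
  have hlift : algebraMap K L (μ + 1) = algebraMap K L μ + 1 := by rw [map_add, map_one]
  -- Adding a small multiple of `x` to `y` cannot give an Artin–Schreier generator.
  have hsmall : ∀ c : K, c ≠ 0 → IsArtinSchreierGenerator K (y + algebraMap K L c * x) →
      ord S x ≤ ord S y → ord S (algebraMap K L c) ≤ 0 := by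
    intro c hc hgen hxy
    by_contra! h
    have h1 := hxmax _ hgen
    have h2 : ord S (algebraMap K L c * x) = ord S (algebraMap K L c) + ord S x :=
      ord_mul (hinj hc) hx0
    rcases lt_or_ge (ord S y) (ord S (algebraMap K L c * x)) with h3 | h3
    · rw [(ord_add_of_lt hy0 h3).1] at h1
      lia
    · have h4 := le_ord_add (S := S) (h := ord S x + 1) (x := y) (y := algebraMap K L c * x)
        (by lia) (by lia) (fun h0 => hgen.1 ⟨0, by rw [h0, map_zero]⟩)
      lia
  have hgen₀ : IsArtinSchreierGenerator K (y + algebraMap K L μ * x) :=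
    isArtinSchreierGenerator_of_apply hσ₁ hσ₂ hσ₁₂
      (Or.inl (by
        rw [map_add, map_mul, AlgEquiv.commutes, hσ₁y, hσ₁x]
        linear_combination algebraMap K L μ * two))
      (by rw [map_add, map_mul, AlgEquiv.commutes, hσ₂y, hσ₂x]; ring) two
  have hgen₁ : IsArtinSchreierGenerator K (y + algebraMap K L (μ + 1) * x) :=
    isArtinSchreierGenerator_of_apply hσ₁ hσ₂ hσ₁₂
      (Or.inr (by
        rw [map_add, map_mul, AlgEquiv.commutes, hσ₁y, hσ₁x, hlift]
        linear_combination algebraMap K L μ * two))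
      (by rw [map_add, map_mul, AlgEquiv.commutes, hσ₂y, hσ₂x]; ring) two
  have hμord : ord S (algebraMap K L (μ + 1)) = ord S (algebraMap K L μ) ∧
      ord S (algebraMap K L μ) ≤ 0 := by
    rcases lt_or_ge (ord S (algebraMap K L μ)) 0 with h | h
    · refine ⟨?_, h.le⟩
      rw [hlift]
      exact (ord_add_of_lt (hinj hμ0) (by rwa [ord_one])).1
    · have h1 : 0 ≤ ord S (algebraMap K L (μ + 1)) := by
        rw [hlift]
        exact le_ord_add h (by rw [ord_one]) (by rw [← hlift]; exact hinj hμ1)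
      have h2 := hsmall μ hμ0 hgen₀ (by lia)
      have h3 := hsmall (μ + 1) hμ1 hgen₁ (by lia)
      lia
  refine ⟨σ₁, σ₂, x, y, μ, -(ord S x / 2), -ord S y, ?_⟩
  exact
    { gal_cases := IsKleinFour.eq_one_or_eq hσ₁ hσ₂ hσ₁₂
      apply₁x := hσ₁x
      apply₂x := hσ₂x
      apply₁y := hσ₁y
      apply₂y := hσ₂y
      ord_x := by lia
      ord_y := by lia
      odd := by lia
      pos := by lia
      le := by lia
      mod_four := by rw [Int.ModEq]; lia
      μ_ne_zero := hμ0
      μ_add_one_ne_zero := hμ1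
      ord_μ := by lia
      ord_μ_add_one := by lia }

end Scaffold

/-! ### Coordinates with respect to the scaffold -/

namespace IsScaffold

section Coordinates

variable {R S K L : Type*} [CommRing R] [IsDomain R] [IsDiscreteValuationRing R] [CommRing S]
  [IsDomain S] [IsDiscreteValuationRing S] [Field K] [Field L] [Algebra R K] [IsFractionRing R K]
  [Algebra K L] [Algebra S L] [IsFractionRing S L]
  {σ₁ σ₂ : Gal(L/K)} {x y : L} {μ : K} {c₁ c₂ : ℤ}

section

omit [CommRing R] [IsDomain R] [IsDiscreteValuationRing R] [Algebra R K] [IsFractionRing R K]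

theorem x_ne_zero (H : IsScaffold S σ₁ σ₂ x y μ c₁ c₂) : x ≠ 0 := by
  rintro rfl
  have := H.apply₁x
  simp at this

theorem y_ne_zero (H : IsScaffold S σ₁ σ₂ x y μ c₁ c₂) : y ≠ 0 := by
  rintro rfl
  have := H.apply₂y
  simp at this

theorem ord_xy (H : IsScaffold S σ₁ σ₂ x y μ c₁ c₂) : ord S (x * y) = -(2 * c₁) - c₂ := by
  rw [ord_mul H.x_ne_zero H.y_ne_zero, H.ord_x, H.ord_y]; ring

theorem monomial_ne_zero (H : IsScaffold S σ₁ σ₂ x y μ c₁ c₂) :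
    ∀ i, (![1, x, y, x * y] : Fin 4 → L) i ≠ 0 := by
  intro i
  fin_cases i
  exacts [one_ne_zero, H.x_ne_zero, H.y_ne_zero, mul_ne_zero H.x_ne_zero H.y_ne_zero]

theorem eq_of_ord_monomial_modEq (H : IsScaffold S σ₁ σ₂ x y μ c₁ c₂) (i j : Fin 4)
    (h : ord S ((![1, x, y, x * y] : Fin 4 → L) i) ≡
      ord S ((![1, x, y, x * y] : Fin 4 → L) j) [ZMOD 4]) : i = j := by
  have h₁ := H.odd
  have h₂ := H.mod_four
  rw [Int.ModEq] at h h₂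
  fin_cases i <;> fin_cases j <;>
    simp only [Fin.zero_eta, Fin.mk_one, Fin.reduceFinMk, Matrix.cons_val, ord_one, H.ord_x,
      H.ord_y, H.ord_xy] at h ⊢ <;> lia

end

variable (hK : ∀ x : K, x ≠ 0 → ord S (algebraMap K L x) = 4 * ord R x)
include hK

theorem smul_mem_primePow_iff {c : K} {z : L} (hz : z ≠ 0) {h : ℤ} :
    c • z ∈ primePow S L h ↔ c = 0 ∨ h ≤ 4 * ord R c + ord S z := by
  rw [mem_primePow_iff, smul_eq_zero_iff_left hz]
  by_cases hc : c = 0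
  · simp [hc]
  · rw [Algebra.smul_def, ord_mul (by simpa using hc) hz, hK c hc]

theorem exists_coord (H : IsScaffold S σ₁ σ₂ x y μ c₁ c₂) (hdim : Module.finrank K L = 4) (z : L) :
    ∃ a₀ a₁ a₂ a₃ : K, z = a₀ • (1 : L) + a₁ • x + a₂ • y + a₃ • (x * y) := by
  obtain ⟨a, ha⟩ := exists_coord_of_ord hdim hK H.monomial_ne_zero H.eq_of_ord_monomial_modEq z
  exact ⟨a 0, a 1, a 2, a 3, by simpa [Fin.sum_univ_four] using ha⟩

theorem sum_mem_primePow (H : IsScaffold S σ₁ σ₂ x y μ c₁ c₂) {a₀ a₁ a₂ a₃ : K} {h : ℤ}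
    (hz : a₀ • (1 : L) + a₁ • x + a₂ • y + a₃ • (x * y) ∈ primePow S L h) :
    a₀ • (1 : L) ∈ primePow S L h ∧ a₁ • x ∈ primePow S L h ∧ a₂ • y ∈ primePow S L h ∧
      a₃ • (x * y) ∈ primePow S L h := by
  have := mem_primePow_of_sum_mem (S := S) (h := h) (ord_smul_distinct hK H.monomial_ne_zero
    H.eq_of_ord_monomial_modEq ![a₀, a₁, a₂, a₃]) (by simpa [Fin.sum_univ_four] using hz)
  exact ⟨this 0, this 1, this 2, this 3⟩

theorem coord_eq_zero (H : IsScaffold S σ₁ σ₂ x y μ c₁ c₂) {a₀ a₁ a₂ a₃ : K}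
    (hz : a₀ • (1 : L) + a₁ • x + a₂ • y + a₃ • (x * y) = 0) :
    a₀ = 0 ∧ a₁ = 0 ∧ a₂ = 0 ∧ a₃ = 0 := by
  have := eq_zero_of_sum_eq_zero (S := S) (ord_smul_distinct hK H.monomial_ne_zero
    H.eq_of_ord_monomial_modEq ![a₀, a₁, a₂, a₃]) (by simpa [Fin.sum_univ_four] using hz)
  have hm := H.monomial_ne_zero
  exact ⟨(smul_eq_zero_iff_left (hm 0)).1 (this 0), (smul_eq_zero_iff_left (hm 1)).1 (this 1),
    (smul_eq_zero_iff_left (hm 2)).1 (this 2), (smul_eq_zero_iff_left (hm 3)).1 (this 3)⟩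

end Coordinates

/-! ### The lower ramification breaks -/

section Breaks

variable {R S K L : Type*} [CommRing R] [IsDomain R] [IsDiscreteValuationRing R] [CommRing S]
  [IsDomain S] [IsDiscreteValuationRing S] [Field K] [Field L] [Algebra R K] [IsFractionRing R K]
  [Algebra K L] [Algebra R L] [IsScalarTower R K L] [Algebra S L] [IsFractionRing S L]
  [IsIntegralClosure S R L] {σ₁ σ₂ : Gal(L/K)} {x y : L} {μ : K} {c₁ c₂ : ℤ}

omit [IsDomain R] [IsDiscreteValuationRing R] [IsFractionRing R K] in
theorem mem_lowerRamificationGroup_iff {σ : Gal(L/K)} {j : ℤ} :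
    σ ∈ lowerRamificationGroup R S K L j ↔
      ∀ z ∈ primePow S L 0, σ z - z ∈ primePow S L (j + 1) := by
  constructor
  · intro h z hz
    obtain ⟨s, rfl⟩ : ∃ s : S, algebraMap S L s = z := by
      rcases mem_primePow_iff.1 hz with rfl | hz
      · exact ⟨0, map_zero _⟩
      · exact exists_algebraMap_eq hz
    exact h s
  · intro h s
    refine h _ (mem_primePow_iff.2 ?_)
    by_cases hs : s = 0
    · simp [hs]
    · exact Or.inr (ord_algebraMap_nonneg hs)

variable (hK : ∀ x : K, x ≠ 0 → ord S (algebraMap K L x) = 4 * ord R x)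
include hK

omit [Algebra R L] [IsScalarTower R K L] [IsIntegralClosure S R L] in
theorem exists_smul_ord_eq {z : L} (hz : z ≠ 0) {n : ℤ} (h : ord S z ≡ n [ZMOD 4]) :
    ∃ c : K, c ≠ 0 ∧ ord S (c • z) = n ∧ 4 * ord R c = n - ord S z := by
  obtain ⟨p, hp⟩ := IsDiscreteValuationRing.exists_irreducible R
  have hp0 : algebraMap R K p ≠ 0 := by simpa using hp.ne_zero
  obtain ⟨m, hm⟩ := h.dvd
  have hc : algebraMap R K p ^ m ≠ 0 := zpow_ne_zero _ hp0
  have ho : ord R (algebraMap R K p ^ m) = m := by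
    rw [ord_zpow, ord_algebraMap_irreducible hp, mul_one]
  refine ⟨algebraMap R K p ^ m, hc, ?_, by rw [ho, hm]⟩
  rw [Algebra.smul_def, ord_mul ((map_ne_zero _).2 hc) hz, hK _ hc, ho]
  lia

/-- An automorphism moving `x` lies in `G_j` exactly for `j ≤ c₁`. -/
theorem mem_lowerRamificationGroup_iff_of_apply_x (H : IsScaffold S σ₁ σ₂ x y μ c₁ c₂) (hdim : Module.finrank K L = 4)
    {τ : Gal(L/K)} {ν : K} (hν : ν ≠ 0) (hνo : ord S (algebraMap K L ν) = c₁ - c₂)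
    (hτx : τ x = x + 1) (hτy : τ y = y + algebraMap K L ν) {j : ℤ} :
    τ ∈ lowerRamificationGroup R S K L j ↔ j ≤ c₁ := by
  have h₁ := H.odd
  have h₂ := H.mod_four
  have h₃ := H.pos
  have hx := H.ord_x
  have hy := H.ord_y
  have hxy := H.ord_xy
  rw [Int.ModEq] at h₂
  have hνL : algebraMap K L ν ≠ 0 := (map_ne_zero _).2 hν
  have hνx : ord S (algebraMap K L ν * x) = -c₁ - c₂ := by
    rw [ord_mul hνL H.x_ne_zero]; lia
  have hνx0 : algebraMap K L ν * x ≠ 0 := mul_ne_zero hνL H.x_ne_zero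
  have hτxy : τ (x * y) = x * y + (y + algebraMap K L ν * x + algebraMap K L ν) := by
    rw [map_mul, hτx, hτy]; ring
  rw [mem_lowerRamificationGroup_iff (R := R)]
  constructor
  · intro h
    -- A `K`-multiple of `y` or of `x y` has order `1`, and is moved to order exactly `1 + c` with `c`
    -- the break of the automorphism.
    have hcase : c₂ % 4 = 3 ∨ (2 * c₁ + c₂) % 4 = 3 := by lia
    rcases hcase with hc | hc
    · obtain ⟨c, hc0, hco, hcR⟩ := exists_smul_ord_eq hK H.y_ne_zero (n := 1)
        (by rw [Int.ModEq]; lia)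
      have h4 := h (c • y) (mem_primePow_iff.2 (Or.inr (by lia)))
      rw [map_smul, hτy, smul_add, add_sub_cancel_left, smul_mem_primePow_iff hK hνL] at h4
      have := h4.resolve_left hc0
      lia
    · obtain ⟨c, hc0, hco, hcR⟩ := exists_smul_ord_eq hK
        (mul_ne_zero H.x_ne_zero H.y_ne_zero) (n := 1) (by rw [Int.ModEq]; lia)
      have h4 := h (c • (x * y)) (mem_primePow_iff.2 (Or.inr (by lia)))
      obtain ⟨h5, h6⟩ := ord_add_of_lt (S := S) (y := y) hνx0 (by lia)
      obtain ⟨h7, h8⟩ := ord_add_of_lt (S := S) (y := algebraMap K L ν) h6 (by lia)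
      rw [add_comm (algebraMap K L ν * x) y] at h5 h7 h8
      rw [map_smul, hτxy, smul_add, add_sub_cancel_left, smul_mem_primePow_iff hK h8] at h4
      have := h4.resolve_left hc0
      lia
  · intro hj z hz
    obtain ⟨a₀, a₁, a₂, a₃, rfl⟩ := H.exists_coord hK hdim z
    obtain ⟨m₀, m₁, m₂, m₃⟩ := H.sum_mem_primePow hK hz
    rw [smul_mem_primePow_iff hK H.x_ne_zero] at m₁
    rw [smul_mem_primePow_iff hK H.y_ne_zero] at m₂
    rw [smul_mem_primePow_iff hK (mul_ne_zero H.x_ne_zero H.y_ne_zero)] at m₃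
    have e : τ (a₀ • (1 : L) + a₁ • x + a₂ • y + a₃ • (x * y)) -
        (a₀ • (1 : L) + a₁ • x + a₂ • y + a₃ • (x * y)) =
        a₁ • (1 : L) + a₂ • algebraMap K L ν +
          (a₃ • y + a₃ • (algebraMap K L ν * x) + a₃ • algebraMap K L ν) := by
      simp only [map_add, map_smul, map_one, hτx, hτy, hτxy, smul_add]
      abel
    have hone : ord S (1 : L) = 0 := ord_one
    rw [e]
    refine add_mem (add_mem ?_ ?_) (add_mem (add_mem ?_ ?_) ?_)
    · rw [smul_mem_primePow_iff hK one_ne_zero]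
      exact m₁.imp_right fun _ => by lia
    · rw [smul_mem_primePow_iff hK hνL]
      exact m₂.imp_right fun _ => by lia
    · rw [smul_mem_primePow_iff hK H.y_ne_zero]
      exact m₃.imp_right fun _ => by lia
    · rw [smul_mem_primePow_iff hK hνx0]
      exact m₃.imp_right fun _ => by lia
    · rw [smul_mem_primePow_iff hK hνL]
      exact m₃.imp_right fun _ => by lia

/-- The automorphism fixing `x` lies in `G_j` exactly for `j ≤ c₂`. -/
theorem mem_lowerRamificationGroup_iff₂ (H : IsScaffold S σ₁ σ₂ x y μ c₁ c₂) (hdim : Module.finrank K L = 4) {j : ℤ} :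
    σ₂ ∈ lowerRamificationGroup R S K L j ↔ j ≤ c₂ := by
  have h₁ := H.odd
  have h₂ := H.mod_four
  have hx := H.ord_x
  have hy := H.ord_y
  have hxy := H.ord_xy
  rw [Int.ModEq] at h₂
  have hone : ord S (1 : L) = 0 := ord_one
  have hσxy : σ₂ (x * y) = x * y + x := by
    rw [map_mul, H.apply₂x, H.apply₂y]; ring
  rw [mem_lowerRamificationGroup_iff (R := R)]
  constructor
  · intro h
    -- A `K`-multiple of `y` or of `x y` has order `1`, and is moved to order exactly `1 + c` with `c`
    -- the break of the automorphism.
    have hcase : c₂ % 4 = 3 ∨ (2 * c₁ + c₂) % 4 = 3 := by lia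
    rcases hcase with hc | hc
    · obtain ⟨c, hc0, hco, hcR⟩ := exists_smul_ord_eq hK H.y_ne_zero (n := 1)
        (by rw [Int.ModEq]; lia)
      have h4 := h (c • y) (mem_primePow_iff.2 (Or.inr (by lia)))
      rw [map_smul, H.apply₂y, smul_add, add_sub_cancel_left,
        smul_mem_primePow_iff hK one_ne_zero] at h4
      have := h4.resolve_left hc0
      lia
    · obtain ⟨c, hc0, hco, hcR⟩ := exists_smul_ord_eq hK
        (mul_ne_zero H.x_ne_zero H.y_ne_zero) (n := 1) (by rw [Int.ModEq]; lia)
      have h4 := h (c • (x * y)) (mem_primePow_iff.2 (Or.inr (by lia)))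
      rw [map_smul, hσxy, smul_add, add_sub_cancel_left,
        smul_mem_primePow_iff hK H.x_ne_zero] at h4
      have := h4.resolve_left hc0
      lia
  · intro hj z hz
    obtain ⟨a₀, a₁, a₂, a₃, rfl⟩ := H.exists_coord hK hdim z
    obtain ⟨m₀, m₁, m₂, m₃⟩ := H.sum_mem_primePow hK hz
    rw [smul_mem_primePow_iff hK H.y_ne_zero] at m₂
    rw [smul_mem_primePow_iff hK (mul_ne_zero H.x_ne_zero H.y_ne_zero)] at m₃
    have e : σ₂ (a₀ • (1 : L) + a₁ • x + a₂ • y + a₃ • (x * y)) -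
        (a₀ • (1 : L) + a₁ • x + a₂ • y + a₃ • (x * y)) = a₂ • (1 : L) + a₃ • x := by
      simp only [map_add, map_smul, map_one, H.apply₂x, H.apply₂y, hσxy, smul_add]
      abel
    rw [e]
    refine add_mem ?_ ?_
    · rw [smul_mem_primePow_iff hK one_ne_zero]
      exact m₂.imp_right fun _ => by lia
    · rw [smul_mem_primePow_iff hK H.x_ne_zero]
      exact m₃.imp_right fun _ => by lia

theorem mem_lowerRamificationGroup_iff₁ (H : IsScaffold S σ₁ σ₂ x y μ c₁ c₂) (hdim : Module.finrank K L = 4) {j : ℤ} :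
    σ₁ ∈ lowerRamificationGroup R S K L j ↔ j ≤ c₁ :=
  H.mem_lowerRamificationGroup_iff_of_apply_x hK hdim H.μ_ne_zero H.ord_μ H.apply₁x H.apply₁y

theorem mem_lowerRamificationGroup_iff₁₂ (H : IsScaffold S σ₁ σ₂ x y μ c₁ c₂) (hdim : Module.finrank K L = 4) {j : ℤ} :
    σ₁ * σ₂ ∈ lowerRamificationGroup R S K L j ↔ j ≤ c₁ := by
  refine H.mem_lowerRamificationGroup_iff_of_apply_x hK hdim H.μ_add_one_ne_zero H.ord_μ_add_one ?_ ?_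
  · rw [AlgEquiv.mul_apply, H.apply₂x, H.apply₁x]
  · rw [AlgEquiv.mul_apply, H.apply₂y, map_add, map_one, H.apply₁y, map_add, map_one, add_assoc]

variable [FiniteDimensional K L]

theorem isLowerBreak_one [IsKleinFour Gal(L/K)] (H : IsScaffold S σ₁ σ₂ x y μ c₁ c₂) (hdim : Module.finrank K L = 4) :
    IsLowerBreak R S K L 2 2 1 c₁ := by
  constructor
  · have htop : lowerRamificationGroup R S K L c₁ = ⊤ := by
      rw [eq_top_iff]
      intro τ _
      rcases H.gal_cases τ with rfl | rfl | rfl | rfl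
      · exact one_mem _
      · exact (H.mem_lowerRamificationGroup_iff₁ hK hdim).2 le_rfl
      · exact (H.mem_lowerRamificationGroup_iff₂ hK hdim).2 H.le
      · exact (H.mem_lowerRamificationGroup_iff₁₂ hK hdim).2 le_rfl
    simp [htop]
  · intro j hj
    by_contra! hlt
    have hsub : (lowerRamificationGroup R S K L j : Set Gal(L/K)) ⊆ {1, σ₂} := by
      intro τ hτ
      rcases H.gal_cases τ with rfl | rfl | rfl | rfl
      · exact Or.inl rfl
      · exact (hlt.not_ge ((H.mem_lowerRamificationGroup_iff₁ hK hdim).1 hτ)).elim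
      · exact Or.inr rfl
      · exact (hlt.not_ge ((H.mem_lowerRamificationGroup_iff₁₂ hK hdim).1 hτ)).elim
    have h1 := Set.ncard_le_ncard hsub (Set.toFinite _)
    have h2 := (Set.ncard_insert_le 1 {σ₂}).trans (by rw [Set.ncard_singleton])
    have h3 : 2 ^ (2 - 1) < (lowerRamificationGroup R S K L j : Set Gal(L/K)).ncard := hj
    lia

theorem isLowerBreak_two (H : IsScaffold S σ₁ σ₂ x y μ c₁ c₂) (hdim : Module.finrank K L = 4) :
    IsLowerBreak R S K L 2 2 2 c₂ := by
  constructor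
  · have h1 : Nontrivial (lowerRamificationGroup R S K L c₂) := by
      rw [Subgroup.nontrivial_iff_exists_ne_one]
      refine ⟨σ₂, (H.mem_lowerRamificationGroup_iff₂ hK hdim).2 le_rfl, ?_⟩
      rintro rfl
      have := H.apply₂y
      simp at this
    simpa using Finite.one_lt_card_iff_nontrivial.2 h1
  · intro j hj
    by_contra! hlt
    have hle := H.le
    have hbot : lowerRamificationGroup R S K L j = ⊥ := by
      rw [eq_bot_iff]
      intro τ hτ
      rcases H.gal_cases τ with rfl | rfl | rfl | rfl
      · exact one_mem _
      · have := (H.mem_lowerRamificationGroup_iff₁ hK hdim).1 hτ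
        lia
      · have := (H.mem_lowerRamificationGroup_iff₂ hK hdim).1 hτ
        lia
      · have := (H.mem_lowerRamificationGroup_iff₁₂ hK hdim).1 hτ
        lia
    simp [hbot] at hj

end Breaks

end IsScaffold

/-! ### The scaffold operators in the group algebra -/

section Operators

variable {K L : Type*} [Field K] [Field L] [Algebra K L]

theorem galoisAlgebraAction_of (σ : Gal(L/K)) (z : L) :
    galoisAlgebraAction K L (MonoidAlgebra.of K _ σ) z = σ z := by
  simp only [galoisAlgebraAction, MonoidAlgebra.lift_of]
  rfl

theorem galoisAlgebraAction_algebraMap (c : K) (z : L) :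
    galoisAlgebraAction K L (algebraMap K _ c) z = c • z := by
  rw [AlgHom.commutes, Module.algebraMap_end_apply]

/-- The operator `σ₂ - 1`, which acts on a scaffold as differentiation with respect to `y`. -/
noncomputable def scaffoldOp₂ (σ₂ : Gal(L/K)) : MonoidAlgebra K Gal(L/K) :=
  MonoidAlgebra.of K _ σ₂ - 1

/-- The operator `σ₁ (1 + μ (σ₂ - 1)) - 1`, which acts on a scaffold as differentiation with respect
to `x`. -/
noncomputable def scaffoldOp₁ (σ₁ σ₂ : Gal(L/K)) (μ : K) : MonoidAlgebra K Gal(L/K) :=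
  MonoidAlgebra.of K _ σ₁ * (1 + algebraMap K _ μ * scaffoldOp₂ σ₂) - 1

theorem scaffoldOp₂_apply (σ₂ : Gal(L/K)) (z : L) :
    galoisAlgebraAction K L (scaffoldOp₂ σ₂) z = σ₂ z - z := by
  rw [scaffoldOp₂, map_sub, map_one, LinearMap.sub_apply, galoisAlgebraAction_of,
    Module.End.one_apply]

theorem scaffoldOp₁_apply (σ₁ σ₂ : Gal(L/K)) (μ : K) (z : L) :
    galoisAlgebraAction K L (scaffoldOp₁ σ₁ σ₂ μ) z =
      σ₁ (z + algebraMap K L μ * (σ₂ z - z)) - z := by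
  rw [scaffoldOp₁, map_sub, map_one, LinearMap.sub_apply, map_mul, Module.End.mul_apply, map_add,
    map_one, map_mul, LinearMap.add_apply, Module.End.one_apply, Module.End.mul_apply,
    galoisAlgebraAction_algebraMap, scaffoldOp₂_apply, galoisAlgebraAction_of,
    Algebra.smul_def]

end Operators

namespace IsScaffold

section Action

variable {S K L : Type*} [CommRing S] [IsDomain S] [IsDiscreteValuationRing S] [Field K] [Field L]
  [Algebra K L] [Algebra S L] [IsFractionRing S L] {σ₁ σ₂ : Gal(L/K)} {x y : L} {μ : K} {c₁ c₂ : ℤ}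

theorem op₂_coord (H : IsScaffold S σ₁ σ₂ x y μ c₁ c₂) (a₀ a₁ a₂ a₃ : K) :
    galoisAlgebraAction K L (scaffoldOp₂ σ₂)
      (a₀ • (1 : L) + a₁ • x + a₂ • y + a₃ • (x * y)) = a₂ • (1 : L) + a₃ • x := by
  rw [scaffoldOp₂_apply]
  simp only [map_add, map_one, map_mul, H.apply₂x, H.apply₂y, Algebra.smul_def, AlgEquiv.commutes]
  ring

variable [CharP K 2]

theorem op₁_coord (H : IsScaffold S σ₁ σ₂ x y μ c₁ c₂) (a₀ a₁ a₂ a₃ : K) :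
    galoisAlgebraAction K L (scaffoldOp₁ σ₁ σ₂ μ)
      (a₀ • (1 : L) + a₁ • x + a₂ • y + a₃ • (x * y)) = a₁ • (1 : L) + a₃ • y := by
  have two := two_eq_zero_of_algebra K L
  rw [scaffoldOp₁_apply]
  simp only [map_add, map_sub, map_one, map_mul, H.apply₂x, H.apply₂y, H.apply₁x,
    H.apply₁y, Algebra.smul_def, AlgEquiv.commutes]
  linear_combination (algebraMap K L a₂ * algebraMap K L μ +
    algebraMap K L a₃ * algebraMap K L μ * (x + 1)) * two

theorem op₁₂_coord (H : IsScaffold S σ₁ σ₂ x y μ c₁ c₂) (a₀ a₁ a₂ a₃ : K) :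
    galoisAlgebraAction K L (scaffoldOp₁ σ₁ σ₂ μ * scaffoldOp₂ σ₂)
      (a₀ • (1 : L) + a₁ • x + a₂ • y + a₃ • (x * y)) = a₃ • (1 : L) := by
  have h := H.op₁_coord a₂ a₃ 0 0
  simp only [zero_smul, add_zero] at h
  rw [map_mul, Module.End.mul_apply, H.op₂_coord, h]

theorem op_sum_coord (H : IsScaffold S σ₁ σ₂ x y μ c₁ c₂) (b₀ b₁ b₂ b₃ a₀ a₁ a₂ a₃ : K) :
    galoisAlgebraAction K L (algebraMap K _ b₀ + b₁ • scaffoldOp₁ σ₁ σ₂ μ +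
      b₂ • scaffoldOp₂ σ₂ + b₃ • (scaffoldOp₁ σ₁ σ₂ μ * scaffoldOp₂ σ₂))
      (a₀ • (1 : L) + a₁ • x + a₂ • y + a₃ • (x * y)) =
      (b₀ * a₀ + b₁ * a₁ + b₂ * a₂ + b₃ * a₃) • (1 : L) + (b₀ * a₁ + b₂ * a₃) • x +
        (b₀ * a₂ + b₁ * a₃) • y + (b₀ * a₃) • (x * y) := by
  rw [map_add (galoisAlgebraAction K L), map_add (galoisAlgebraAction K L),
    map_add (galoisAlgebraAction K L), map_smul (galoisAlgebraAction K L),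
    map_smul (galoisAlgebraAction K L), map_smul (galoisAlgebraAction K L)]
  simp only [LinearMap.add_apply, LinearMap.smul_apply]
  rw [galoisAlgebraAction_algebraMap, H.op₁_coord, H.op₂_coord, H.op₁₂_coord]
  module

variable [FiniteDimensional K L] [IsGalois K L]

/-- The element `x y` is a normal basis generator, so an element of the group algebra is determined
by its value there. -/
theorem exists_op_sum (H : IsScaffold S σ₁ σ₂ x y μ c₁ c₂)
    (hcoord : ∀ z : L, ∃ a₀ a₁ a₂ a₃ : K, z = a₀ • (1 : L) + a₁ • x + a₂ • y + a₃ • (x * y)) :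
    Function.Injective (fun α => galoisAlgebraAction K L α (x * y)) ∧
    ∀ α : MonoidAlgebra K Gal(L/K), ∃ b₀ b₁ b₂ b₃ : K,
      α = algebraMap K _ b₀ + b₁ • scaffoldOp₁ σ₁ σ₂ μ + b₂ • scaffoldOp₂ σ₂ +
        b₃ • (scaffoldOp₁ σ₁ σ₂ μ * scaffoldOp₂ σ₂) := by
  let f : MonoidAlgebra K Gal(L/K) →ₗ[K] L :=
    (LinearMap.applyₗ (x * y)).comp (galoisAlgebraAction K L).toLinearMap
  have hf : ∀ α, f α = galoisAlgebraAction K L α (x * y) := fun α => rfl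
  have key : ∀ b₀ b₁ b₂ b₃ : K, f (algebraMap K _ b₀ + b₁ • scaffoldOp₁ σ₁ σ₂ μ +
      b₂ • scaffoldOp₂ σ₂ + b₃ • (scaffoldOp₁ σ₁ σ₂ μ * scaffoldOp₂ σ₂)) =
      b₃ • (1 : L) + b₂ • x + b₁ • y + b₀ • (x * y) := fun b₀ b₁ b₂ b₃ => by
    simpa only [zero_smul, zero_add, one_smul, mul_zero, mul_one, add_zero, hf]
      using H.op_sum_coord b₀ b₁ b₂ b₃ 0 0 0 1
  have hsurj : Function.Surjective f := fun z => by
    obtain ⟨a₀, a₁, a₂, a₃, rfl⟩ := hcoord z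
    exact ⟨_, key a₃ a₂ a₁ a₀⟩
  have hfin : Module.Finite K (MonoidAlgebra K Gal(L/K)) :=
    Module.Finite.equiv (MonoidAlgebra.coeffLinearEquiv (S := K) (M := Gal(L/K)) K).symm
  have hrank : Module.finrank K (MonoidAlgebra K Gal(L/K)) = Module.finrank K L := by
    rw [(MonoidAlgebra.coeffLinearEquiv (S := K) (M := Gal(L/K)) K).finrank_eq,
      Module.finrank_finsupp_self, ← Nat.card_eq_fintype_card, IsGalois.card_aut_eq_finrank]
  have hinj : Function.Injective f :=
    (LinearMap.injective_iff_surjective_of_finrank_eq_finrank hrank).2 hsurj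
  refine ⟨hinj, fun α => ?_⟩
  obtain ⟨a₀, a₁, a₂, a₃, ha⟩ := hcoord (f α)
  exact ⟨a₃, a₂, a₁, a₀, hinj (by rw [ha, key])⟩

omit [FiniteDimensional K L] [IsGalois K L] in
theorem op_mul_eq_zero (H : IsScaffold S σ₁ σ₂ x y μ c₁ c₂)
    (hinj : Function.Injective (fun α => galoisAlgebraAction K L α (x * y))) :
    scaffoldOp₁ σ₁ σ₂ μ * scaffoldOp₁ σ₁ σ₂ μ = 0 ∧ scaffoldOp₂ σ₂ * scaffoldOp₂ σ₂ = 0 ∧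
      scaffoldOp₂ σ₂ * scaffoldOp₁ σ₁ σ₂ μ = scaffoldOp₁ σ₁ σ₂ μ * scaffoldOp₂ σ₂ := by
  have h₁ := H.op₁_coord
  have h₂ := H.op₂_coord
  have h₁xy := h₁ 0 0 0 1
  have h₂xy := h₂ 0 0 0 1
  have h₁y := h₁ 0 0 1 0
  have h₂x := h₂ 0 1 0 0
  have h₁x := h₁ 0 1 0 0
  have h₂y := h₂ 0 0 1 0
  simp only [zero_smul, one_smul, zero_add, add_zero] at h₁xy h₂xy h₁y h₂x h₁x h₂y
  refine ⟨hinj ?_, hinj ?_, hinj ?_⟩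
  · simp [h₁xy, h₁y]
  · simp [h₂xy, h₂x]
  · simp [h₁xy, h₂xy, h₁x, h₂y]

end Action

end IsScaffold

/-! ### The associated order of a power of the maximal ideal -/

section PrimePow

variable {R K : Type*} [CommRing R] [IsDomain R] [IsDiscreteValuationRing R] [Field K] [Algebra R K]
  [IsFractionRing R K]

theorem primePow_antitone {m n : ℤ} (h : m ≤ n) {a : K} (ha : a ∈ primePow R K n) :
    a ∈ primePow R K m := by
  rw [mem_primePow_iff] at ha ⊢
  exact ha.imp_right h.trans

theorem mul_mem_primePow {m n : ℤ} {a b : K} (ha : a ∈ primePow R K m) (hb : b ∈ primePow R K n) :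
    a * b ∈ primePow R K (m + n) := by
  rw [mem_primePow_iff] at ha hb ⊢
  rcases eq_or_ne a 0 with rfl | ha0
  · simp
  rcases eq_or_ne b 0 with rfl | hb0
  · simp
  right
  rw [ord_mul ha0 hb0]
  exact add_le_add (ha.resolve_left ha0) (hb.resolve_left hb0)

variable {p : R}

theorem zpow_mem_primePow (hp : Irreducible p) (n : ℤ) :
    algebraMap R K p ^ n ∈ primePow R K n := by
  rw [mem_primePow_iff, ord_zpow, ord_algebraMap_irreducible hp, mul_one]
  exact Or.inr le_rfl

theorem mem_primePow_of_mul_zpow_mem (hp : Irreducible p) {m n : ℤ} {a : K}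
    (h : a * algebraMap R K p ^ n ∈ primePow R K m) : a ∈ primePow R K (m - n) := by
  have hp0 : algebraMap R K p ≠ 0 := by simpa using hp.ne_zero
  have h1 := mul_mem_primePow h (zpow_mem_primePow hp (-n))
  rwa [mul_assoc, ← zpow_add₀ hp0, add_neg_cancel, zpow_zero, mul_one, ← sub_eq_add_neg] at h1

theorem mem_primePow_iff_exists (hp : Irreducible p) {n : ℤ} {a : K} :
    a ∈ primePow R K n ↔ ∃ r : R, a = algebraMap R K r * algebraMap R K p ^ n := by
  have hp0 : algebraMap R K p ≠ 0 := by simpa using hp.ne_zero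
  have hR : ∀ r : R, algebraMap R K r ∈ primePow R K 0 := fun r => by
    rw [mem_primePow_iff]
    by_cases hr : r = 0
    · simp [hr]
    · exact Or.inr (ord_algebraMap_nonneg hr)
  constructor
  · intro h
    have h1 := mul_mem_primePow h (zpow_mem_primePow hp (-n))
    rw [add_neg_cancel] at h1
    obtain ⟨r, hr⟩ : ∃ r : R, algebraMap R K r = a * algebraMap R K p ^ (-n) := by
      rcases mem_primePow_iff.1 h1 with h | h
      · exact ⟨0, by rw [h, map_zero]⟩
      · exact exists_algebraMap_eq h
    refine ⟨r, ?_⟩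
    rw [hr, mul_assoc, ← zpow_add₀ hp0, neg_add_cancel, zpow_zero, mul_one]
  · rintro ⟨r, rfl⟩
    have h1 := mul_mem_primePow (hR r) (zpow_mem_primePow (K := K) hp n)
    rwa [zero_add] at h1

omit [IsDomain R] [IsDiscreteValuationRing R] [IsFractionRing R K] in
theorem algebraMap_pow_toNat {m : ℤ} (hm : 0 ≤ m) :
    algebraMap R K (p ^ m.toNat) = algebraMap R K p ^ m := by
  rw [map_pow, ← zpow_natCast, Int.toNat_of_nonneg hm]

end PrimePow

/-- `𝔓_L ^ h` is the direct sum of `𝔓_K ^ n₀`, `𝔓_K ^ n₁ x`, `𝔓_K ^ n₂ y` and `𝔓_K ^ n₃ x y`: the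
exponents `nᵢ` are the roundings up of `(h - v) / 4`, with `v` the order of the monomial. -/
structure IsLatticeExponents (h c₁ c₂ n₀ n₁ n₂ n₃ : ℤ) : Prop where
  le₀ : h ≤ 4 * n₀
  lt₀ : 4 * n₀ < h + 4
  le₁ : h ≤ 4 * n₁ - 2 * c₁
  lt₁ : 4 * n₁ - 2 * c₁ < h + 4
  le₂ : h ≤ 4 * n₂ - c₂
  lt₂ : 4 * n₂ - c₂ < h + 4
  le₃ : h ≤ 4 * n₃ - 2 * c₁ - c₂
  lt₃ : 4 * n₃ - 2 * c₁ - c₂ < h + 4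

namespace IsScaffold

variable {R S K L : Type*} [CommRing R] [IsDomain R] [IsDiscreteValuationRing R] [CommRing S]
  [IsDomain S] [IsDiscreteValuationRing S] [Field K] [Field L] [Algebra R K] [IsFractionRing R K]
  [Algebra K L] [Algebra S L] [IsFractionRing S L]
  {σ₁ σ₂ : Gal(L/K)} {x y : L} {μ : K} {c₁ c₂ : ℤ}
  (hK : ∀ x : K, x ≠ 0 → ord S (algebraMap K L x) = 4 * ord R x)
  {h n₀ n₁ n₂ n₃ : ℤ} {p : R}

section

include hK

theorem mem_primePow_iff_coord (H : IsScaffold S σ₁ σ₂ x y μ c₁ c₂)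
    (N : IsLatticeExponents h c₁ c₂ n₀ n₁ n₂ n₃) {a₀ a₁ a₂ a₃ : K} :
    a₀ • (1 : L) + a₁ • x + a₂ • y + a₃ • (x * y) ∈ primePow S L h ↔
      a₀ ∈ primePow R K n₀ ∧ a₁ ∈ primePow R K n₁ ∧ a₂ ∈ primePow R K n₂ ∧
        a₃ ∈ primePow R K n₃ := by
  have key : ∀ {a : K} {z : L} {n : ℤ}, z ≠ 0 → h ≤ 4 * n + ord S z → 4 * n + ord S z < h + 4 →
      (a • z ∈ primePow S L h ↔ a ∈ primePow R K n) := by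
    intro a z n hz h1 h2
    rw [smul_mem_primePow_iff hK hz, mem_primePow_iff]
    exact or_congr_right ⟨fun _ => by lia, fun _ => by lia⟩
  have hx := H.ord_x
  have hy := H.ord_y
  have hxy := H.ord_xy
  have hone : ord S (1 : L) = 0 := ord_one
  have hxy0 := mul_ne_zero H.x_ne_zero H.y_ne_zero
  have k₀ := fun a => key (a := a) (z := 1) (n := n₀) one_ne_zero (by linarith [N.le₀])
    (by linarith [N.lt₀])
  have k₁ := fun a => key (a := a) (n := n₁) H.x_ne_zero (by linarith [N.le₁])
    (by linarith [N.lt₁])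
  have k₂ := fun a => key (a := a) (n := n₂) H.y_ne_zero (by linarith [N.le₂])
    (by linarith [N.lt₂])
  have k₃ := fun a => key (a := a) (n := n₃) hxy0 (by linarith [N.le₃]) (by linarith [N.lt₃])
  constructor
  · intro hz
    obtain ⟨m₀, m₁, m₂, m₃⟩ := H.sum_mem_primePow hK hz
    exact ⟨(k₀ _).1 m₀, (k₁ _).1 m₁, (k₂ _).1 m₂, (k₃ _).1 m₃⟩
  · rintro ⟨m₀, m₁, m₂, m₃⟩
    exact add_mem (add_mem (add_mem ((k₀ _).2 m₀) ((k₁ _).2 m₁)) ((k₂ _).2 m₂)) ((k₃ _).2 m₃)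

variable [CharP K 2]

/-- The associated order is spanned by multiples of the monomials in the scaffold operators; the
exponents are dictated by the action on the monomial basis of `𝔓_L ^ h`. -/
theorem mem_associatedOrder_iff (H : IsScaffold S σ₁ σ₂ x y μ c₁ c₂)
    (N : IsLatticeExponents h c₁ c₂ n₀ n₁ n₂ n₃) (hp : Irreducible p)
    (hdim : Module.finrank K L = 4) {b₀ b₁ b₂ b₃ : K} :
    algebraMap K _ b₀ + b₁ • scaffoldOp₁ σ₁ σ₂ μ + b₂ • scaffoldOp₂ σ₂ +
        b₃ • (scaffoldOp₁ σ₁ σ₂ μ * scaffoldOp₂ σ₂) ∈ associatedOrder K (primePow S L h) ↔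
      b₀ ∈ primePow R K 0 ∧ b₁ ∈ primePow R K (max (n₀ - n₁) (n₂ - n₃)) ∧
        b₂ ∈ primePow R K (max (n₀ - n₂) (n₁ - n₃)) ∧ b₃ ∈ primePow R K (n₀ - n₃) := by
  have hmem := fun a₀ a₁ a₂ a₃ => H.mem_primePow_iff_coord hK N (a₀ := a₀) (a₁ := a₁) (a₂ := a₂)
    (a₃ := a₃)
  have hmax : ∀ {b : K} {m n : ℤ}, b ∈ primePow R K m → b ∈ primePow R K n →
      b ∈ primePow R K (max m n) := fun {b m n} hm hn => by
    rcases max_choice m n with e | e <;> rw [e] <;> assumption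
  constructor
  · intro hα
    have hα' : ∀ z ∈ primePow S L h, galoisAlgebraAction K L (algebraMap K _ b₀ +
        b₁ • scaffoldOp₁ σ₁ σ₂ μ + b₂ • scaffoldOp₂ σ₂ +
        b₃ • (scaffoldOp₁ σ₁ σ₂ μ * scaffoldOp₂ σ₂)) z ∈ primePow S L h := hα
    have h₁ := hα' _ ((hmem 0 (algebraMap R K p ^ n₁) 0 0).2
      ⟨zero_mem _, zpow_mem_primePow hp _, zero_mem _, zero_mem _⟩)
    have h₂ := hα' _ ((hmem 0 0 (algebraMap R K p ^ n₂) 0).2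
      ⟨zero_mem _, zero_mem _, zpow_mem_primePow hp _, zero_mem _⟩)
    have h₃ := hα' _ ((hmem 0 0 0 (algebraMap R K p ^ n₃)).2
      ⟨zero_mem _, zero_mem _, zero_mem _, zpow_mem_primePow hp _⟩)
    rw [H.op_sum_coord, hmem] at h₁ h₂ h₃
    simp only [mul_zero, zero_add, add_zero] at h₁ h₂ h₃
    have e := mem_primePow_of_mul_zpow_mem hp h₃.2.2.2
    rw [sub_self] at e
    exact ⟨e, hmax (mem_primePow_of_mul_zpow_mem hp h₁.1)
      (mem_primePow_of_mul_zpow_mem hp h₃.2.2.1), hmax (mem_primePow_of_mul_zpow_mem hp h₂.1)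
      (mem_primePow_of_mul_zpow_mem hp h₃.2.1), mem_primePow_of_mul_zpow_mem hp h₃.1⟩
  · rintro ⟨m₀, m₁, m₂, m₃⟩ z hz
    obtain ⟨a₀, a₁, a₂, a₃, rfl⟩ := H.exists_coord hK hdim z
    rw [hmem] at hz
    obtain ⟨z₀, z₁, z₂, z₃⟩ := hz
    rw [H.op_sum_coord, hmem]
    have mm : ∀ {b a : K} {m n l : ℤ}, b ∈ primePow R K m → a ∈ primePow R K n → l ≤ m + n →
        b * a ∈ primePow R K l := fun hb ha hl => primePow_antitone hl (mul_mem_primePow hb ha)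
    have l₁ := le_max_left (n₀ - n₁) (n₂ - n₃)
    have l₁' := le_max_right (n₀ - n₁) (n₂ - n₃)
    have l₂ := le_max_left (n₀ - n₂) (n₁ - n₃)
    have l₂' := le_max_right (n₀ - n₂) (n₁ - n₃)
    refine ⟨add_mem (add_mem (add_mem (mm m₀ z₀ ?_) (mm m₁ z₁ ?_)) (mm m₂ z₂ ?_)) (mm m₃ z₃ ?_),
      add_mem (mm m₀ z₁ ?_) (mm m₂ z₃ ?_), add_mem (mm m₀ z₂ ?_) (mm m₁ z₃ ?_), mm m₀ z₃ ?_⟩ <;>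
    lia

end

variable [CharP K 2] [FiniteDimensional K L] [IsGalois K L] [IsKleinFour Gal(L/K)]

include hK in
/-- The associated order of `𝔓_L ^ h` is a monomial order, and `𝔓_L ^ h` a monomial module over it,
with structure constants read off from the exponents. -/
theorem exists_isMonomialOrder (H : IsScaffold S σ₁ σ₂ x y μ c₁ c₂)
    (N : IsLatticeExponents h c₁ c₂ n₀ n₁ n₂ n₃) (hp : Irreducible p)
    (hdim : Module.finrank K L = 4) {w₁ w₂ w₃ : ℤ} (hw₁ : w₁ = max (n₀ - n₁) (n₂ - n₃))
    (hw₂ : w₂ = max (n₀ - n₂) (n₁ - n₃)) (hw₃ : w₃ = n₀ - n₃) :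
    ∃ (ι : R →+* associatedOrder K (primePow S L h))
      (Φ₁ Φ₂ Φ₃ : associatedOrder K (primePow S L h)) (E₀ E₁ E₂ E₃ : primePow S L h) (c d : R),
      IsMonomialOrder ι Φ₁ Φ₂ Φ₃ (p ^ (w₁ + w₂ - w₃).toNat) ∧
      IsMonomialModule ι Φ₁ Φ₂ Φ₃ E₀ E₁ E₂ E₃ (p ^ (w₁ + n₃ - n₂).toNat)
        (p ^ (w₂ + n₃ - n₁).toNat) c d := by
  have hp0 : algebraMap R K p ≠ 0 := by simpa using hp.ne_zero
  have hA := fun b₀ b₁ b₂ b₃ => H.mem_associatedOrder_iff hK N hp hdim (b₀ := b₀) (b₁ := b₁)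
    (b₂ := b₂) (b₃ := b₃)
  rw [← hw₁, ← hw₂, ← hw₃] at hA
  have hM := fun a₀ a₁ a₂ a₃ => H.mem_primePow_iff_coord hK N (a₀ := a₀) (a₁ := a₁) (a₂ := a₂)
    (a₃ := a₃)
  obtain ⟨hinj, hop⟩ := H.exists_op_sum (H.exists_coord hK hdim)
  obtain ⟨sq₁, sq₂, comm⟩ := H.op_mul_eq_zero hinj
  have l₁ : n₀ - n₁ ≤ w₁ := hw₁ ▸ le_max_left _ _
  have l₁' : n₂ - n₃ ≤ w₁ := hw₁ ▸ le_max_right _ _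
  have l₂ : n₀ - n₂ ≤ w₂ := hw₂ ▸ le_max_left _ _
  have l₂' : n₁ - n₃ ≤ w₂ := hw₂ ▸ le_max_right _ _
  set ϖ : K := algebraMap R K p with hϖ
  set Ψ₁ := scaffoldOp₁ σ₁ σ₂ μ with hΨ₁
  set Ψ₂ := scaffoldOp₂ (K := K) σ₂ with hΨ₂
  have hpow : ∀ {m n l : ℤ}, 0 ≤ m → m + n = l → algebraMap R K (p ^ m.toNat) * ϖ ^ n = ϖ ^ l :=
    fun hm hl => by rw [algebraMap_pow_toNat hm, ← zpow_add₀ hp0, hl]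
  have hz : (0 : K) ∈ primePow R K 0 := zero_mem _
  have hR : ∀ r : R, algebraMap R K r ∈ primePow R K 0 := fun r =>
    (mem_primePow_iff_exists hp).2 ⟨r, by simp⟩
  -- The elements of the associated order and of `𝔓_L ^ h`.
  have mι : ∀ r : R, algebraMap K (MonoidAlgebra K Gal(L/K)) (algebraMap R K r) ∈
      associatedOrder K (primePow S L h) := fun r => by
    simpa using (hA (algebraMap R K r) 0 0 0).2 ⟨hR r, zero_mem _, zero_mem _, zero_mem _⟩
  have mΦ₁ : ϖ ^ w₁ • Ψ₁ ∈ associatedOrder K (primePow S L h) := by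
    simpa using (hA 0 (ϖ ^ w₁) 0 0).2 ⟨hz, zpow_mem_primePow hp _, zero_mem _, zero_mem _⟩
  have mΦ₂ : ϖ ^ w₂ • Ψ₂ ∈ associatedOrder K (primePow S L h) := by
    simpa using (hA 0 0 (ϖ ^ w₂) 0).2 ⟨hz, zero_mem _, zpow_mem_primePow hp _, zero_mem _⟩
  have mΦ₃ : ϖ ^ w₃ • (Ψ₁ * Ψ₂) ∈ associatedOrder K (primePow S L h) := by
    simpa using (hA 0 0 0 (ϖ ^ w₃)).2 ⟨hz, zero_mem _, zero_mem _, zpow_mem_primePow hp _⟩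
  have mE₀ : ϖ ^ n₀ • (1 : L) ∈ primePow S L h := by
    simpa using (hM (ϖ ^ n₀) 0 0 0).2 ⟨zpow_mem_primePow hp _, zero_mem _, zero_mem _, zero_mem _⟩
  have mE₁ : ϖ ^ n₁ • x ∈ primePow S L h := by
    simpa using (hM 0 (ϖ ^ n₁) 0 0).2 ⟨zero_mem _, zpow_mem_primePow hp _, zero_mem _, zero_mem _⟩
  have mE₂ : ϖ ^ n₂ • y ∈ primePow S L h := by
    simpa using (hM 0 0 (ϖ ^ n₂) 0).2 ⟨zero_mem _, zero_mem _, zpow_mem_primePow hp _, zero_mem _⟩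
  have mE₃ : ϖ ^ n₃ • (x * y) ∈ primePow S L h := by
    simpa using (hM 0 0 0 (ϖ ^ n₃)).2 ⟨zero_mem _, zero_mem _, zero_mem _, zpow_mem_primePow hp _⟩
  let ι : R →+* associatedOrder K (primePow S L h) :=
    { toFun := fun r => ⟨algebraMap K _ (algebraMap R K r), mι r⟩
      map_one' := Subtype.ext (by simp only [map_one]; rfl)
      map_mul' := fun r s => Subtype.ext (by simp only [map_mul]; rfl)
      map_zero' := Subtype.ext (by simp only [map_zero]; rfl)
      map_add' := fun r s => Subtype.ext (by simp only [map_add]; rfl) }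
  have hιmul : ∀ (r : R) (w : ℤ) (Ψ : MonoidAlgebra K Gal(L/K)),
      algebraMap K (MonoidAlgebra K Gal(L/K)) (algebraMap R K r) * (ϖ ^ w • Ψ) =
        (algebraMap R K r * ϖ ^ w) • Ψ := fun r w Ψ => by rw [← Algebra.smul_def, smul_smul]
  have hιsmul : ∀ (r : R) (n : ℤ) (z : L),
      galoisAlgebraAction K L (algebraMap K _ (algebraMap R K r)) (ϖ ^ n • z) =
        (algebraMap R K r * ϖ ^ n) • z := fun r n z => by
    rw [galoisAlgebraAction_algebraMap, smul_smul]
  -- The action of the operators on the monomials.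
  have op₁ := H.op₁_coord
  have op₂ := H.op₂_coord
  rw [← hΨ₁] at op₁
  rw [← hΨ₂] at op₂
  have u₁₀ := op₁ 1 0 0 0
  have u₁₁ := op₁ 0 1 0 0
  have u₁₂ := op₁ 0 0 1 0
  have u₁₃ := op₁ 0 0 0 1
  have u₂₀ := op₂ 1 0 0 0
  have u₂₁ := op₂ 0 1 0 0
  have u₂₂ := op₂ 0 0 1 0
  have u₂₃ := op₂ 0 0 0 1
  simp only [zero_smul, one_smul, zero_add, add_zero] at u₁₀ u₁₁ u₁₂ u₁₃ u₂₀ u₂₁ u₂₂ u₂₃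
  have act : ∀ (w n : ℤ) (Ψ : MonoidAlgebra K Gal(L/K)) (z : L),
      galoisAlgebraAction K L (ϖ ^ w • Ψ) (ϖ ^ n • z) =
        ϖ ^ (w + n) • galoisAlgebraAction K L Ψ z := fun w n Ψ z => by
    rw [map_smul, map_smul, LinearMap.smul_apply, smul_smul, ← zpow_add₀ hp0, add_comm]
  refine ⟨ι, ⟨_, mΦ₁⟩, ⟨_, mΦ₂⟩, ⟨_, mΦ₃⟩, ⟨_, mE₀⟩, ⟨_, mE₁⟩, ⟨_, mE₂⟩, ⟨_, mE₃⟩,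
    p ^ (w₁ + n₁ - n₀).toNat, p ^ (w₂ + n₂ - n₀).toNat, ?_, ?_⟩
  · refine
      { exists_coord := fun α => ?_
        coord_eq_zero := fun r₀ r₁ r₂ r₃ h0 => ?_
        sq₁ := Subtype.ext ?_
        sq₂ := Subtype.ext ?_
        mul₁₂ := Subtype.ext ?_
        mul₁₃ := Subtype.ext ?_
        mul₂₃ := Subtype.ext ?_
        sq₃ := Subtype.ext ?_ }
    · obtain ⟨α, hα⟩ := α
      obtain ⟨b₀, b₁, b₂, b₃, rfl⟩ := hop α
      obtain ⟨m₀, m₁, m₂, m₃⟩ := (hA _ _ _ _).1 hα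
      rw [mem_primePow_iff_exists hp] at m₀ m₁ m₂ m₃
      obtain ⟨r₀, rfl⟩ := m₀
      obtain ⟨r₁, rfl⟩ := m₁
      obtain ⟨r₂, rfl⟩ := m₂
      obtain ⟨r₃, rfl⟩ := m₃
      refine ⟨r₀, r₁, r₂, r₃, Subtype.ext ?_⟩
      change _ = algebraMap K _ (algebraMap R K r₀) + algebraMap K _ (algebraMap R K r₁) * _ +
        algebraMap K _ (algebraMap R K r₂) * _ + algebraMap K _ (algebraMap R K r₃) * _
      rw [hιmul, hιmul, hιmul]
      simp only [zpow_zero, mul_one]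
      rfl
    · have h1 : algebraMap K _ (algebraMap R K r₀) + algebraMap K _ (algebraMap R K r₁) *
          (ϖ ^ w₁ • Ψ₁) + algebraMap K _ (algebraMap R K r₂) * (ϖ ^ w₂ • Ψ₂) +
          algebraMap K _ (algebraMap R K r₃) * (ϖ ^ w₃ • (Ψ₁ * Ψ₂)) = 0 := congrArg Subtype.val h0
      have h2 := H.op_sum_coord (algebraMap R K r₀) (algebraMap R K r₁ * ϖ ^ w₁)
        (algebraMap R K r₂ * ϖ ^ w₂) (algebraMap R K r₃ * ϖ ^ w₃) 0 0 0 1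
      rw [hιmul, hιmul, hιmul] at h1
      rw [h1, map_zero, LinearMap.zero_apply] at h2
      simp only [mul_zero, zero_add, mul_one] at h2
      obtain ⟨e₃, e₂, e₁, e₀⟩ := H.coord_eq_zero hK h2.symm
      have hϖ0 : ∀ w : ℤ, ϖ ^ w ≠ 0 := fun w => zpow_ne_zero _ hp0
      simp only [mul_eq_zero, hϖ0, or_false, FaithfulSMul.algebraMap_eq_zero_iff] at e₀ e₁ e₂ e₃
      exact ⟨e₀, e₁, e₂, e₃⟩
    · change (ϖ ^ w₁ • Ψ₁) * (ϖ ^ w₁ • Ψ₁) = 0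
      rw [smul_mul_smul_comm, sq₁, smul_zero]
    · change (ϖ ^ w₂ • Ψ₂) * (ϖ ^ w₂ • Ψ₂) = 0
      rw [smul_mul_smul_comm, sq₂, smul_zero]
    · change (ϖ ^ w₁ • Ψ₁) * (ϖ ^ w₂ • Ψ₂) =
        algebraMap K _ (algebraMap R K (p ^ _)) * (ϖ ^ w₃ • (Ψ₁ * Ψ₂))
      rw [hιmul, smul_mul_smul_comm, ← zpow_add₀ hp0, hpow (by lia) (sub_add_cancel _ _)]
    · change (ϖ ^ w₁ • Ψ₁) * (ϖ ^ w₃ • (Ψ₁ * Ψ₂)) = 0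
      rw [smul_mul_smul_comm, ← mul_assoc, sq₁, zero_mul, smul_zero]
    · change (ϖ ^ w₂ • Ψ₂) * (ϖ ^ w₃ • (Ψ₁ * Ψ₂)) = 0
      rw [smul_mul_smul_comm, ← mul_assoc, comm, mul_assoc, sq₂, mul_zero, smul_zero]
    · change (ϖ ^ w₃ • (Ψ₁ * Ψ₂)) * (ϖ ^ w₃ • (Ψ₁ * Ψ₂)) = 0
      rw [smul_mul_smul_comm, mul_assoc, ← mul_assoc Ψ₂, comm, mul_assoc Ψ₁ Ψ₂, sq₂, mul_zero,
        mul_zero, smul_zero]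
  · refine
      { exists_coord := fun z => ?_
        coord_eq_zero := fun r₀ r₁ r₂ r₃ h0 => ?_
        smul₁₀ := Subtype.ext ?_
        smul₁₁ := Subtype.ext ?_
        smul₁₂ := Subtype.ext ?_
        smul₁₃ := Subtype.ext ?_
        smul₂₀ := Subtype.ext ?_
        smul₂₁ := Subtype.ext ?_
        smul₂₂ := Subtype.ext ?_
        smul₂₃ := Subtype.ext ?_
        smul₃₀ := Subtype.ext ?_
        smul₃₁ := Subtype.ext ?_
        smul₃₂ := Subtype.ext ?_
        smul₃₃ := Subtype.ext ?_ }
    · obtain ⟨z, hz⟩ := z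
      obtain ⟨a₀, a₁, a₂, a₃, rfl⟩ := H.exists_coord hK hdim z
      obtain ⟨m₀, m₁, m₂, m₃⟩ := (hM _ _ _ _).1 hz
      rw [mem_primePow_iff_exists hp] at m₀ m₁ m₂ m₃
      obtain ⟨r₀, rfl⟩ := m₀
      obtain ⟨r₁, rfl⟩ := m₁
      obtain ⟨r₂, rfl⟩ := m₂
      obtain ⟨r₃, rfl⟩ := m₃
      refine ⟨r₀, r₁, r₂, r₃, Subtype.ext ?_⟩
      change _ = galoisAlgebraAction K L (algebraMap K _ (algebraMap R K r₀)) _ +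
        galoisAlgebraAction K L (algebraMap K _ (algebraMap R K r₁)) _ +
        galoisAlgebraAction K L (algebraMap K _ (algebraMap R K r₂)) _ +
        galoisAlgebraAction K L (algebraMap K _ (algebraMap R K r₃)) _
      rw [hιsmul, hιsmul, hιsmul, hιsmul]
    · have h1 : galoisAlgebraAction K L (algebraMap K _ (algebraMap R K r₀)) (ϖ ^ n₀ • (1 : L)) +
          galoisAlgebraAction K L (algebraMap K _ (algebraMap R K r₁)) (ϖ ^ n₁ • x) +
          galoisAlgebraAction K L (algebraMap K _ (algebraMap R K r₂)) (ϖ ^ n₂ • y) +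
          galoisAlgebraAction K L (algebraMap K _ (algebraMap R K r₃)) (ϖ ^ n₃ • (x * y)) = 0 :=
        congrArg Subtype.val h0
      rw [hιsmul, hιsmul, hιsmul, hιsmul] at h1
      obtain ⟨e₀, e₁, e₂, e₃⟩ := H.coord_eq_zero hK h1
      have hϖ0 : ∀ w : ℤ, ϖ ^ w ≠ 0 := fun w => zpow_ne_zero _ hp0
      simp only [mul_eq_zero, hϖ0, or_false, FaithfulSMul.algebraMap_eq_zero_iff] at e₀ e₁ e₂ e₃
      exact ⟨e₀, e₁, e₂, e₃⟩
    · change galoisAlgebraAction K L (ϖ ^ w₁ • Ψ₁) (ϖ ^ n₀ • (1 : L)) = 0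
      rw [act, u₁₀, smul_zero]
    · change galoisAlgebraAction K L (ϖ ^ w₁ • Ψ₁) (ϖ ^ n₁ • x) =
        galoisAlgebraAction K L (algebraMap K _ (algebraMap R K (p ^ _))) (ϖ ^ n₀ • (1 : L))
      rw [act, u₁₁, hιsmul, hpow (by lia) (sub_add_cancel _ _)]
    · change galoisAlgebraAction K L (ϖ ^ w₁ • Ψ₁) (ϖ ^ n₂ • y) = 0
      rw [act, u₁₂, smul_zero]
    · change galoisAlgebraAction K L (ϖ ^ w₁ • Ψ₁) (ϖ ^ n₃ • (x * y)) =
        galoisAlgebraAction K L (algebraMap K _ (algebraMap R K (p ^ _))) (ϖ ^ n₂ • y)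
      rw [act, u₁₃, hιsmul, hpow (by lia) (sub_add_cancel _ _)]
    · change galoisAlgebraAction K L (ϖ ^ w₂ • Ψ₂) (ϖ ^ n₀ • (1 : L)) = 0
      rw [act, u₂₀, smul_zero]
    · change galoisAlgebraAction K L (ϖ ^ w₂ • Ψ₂) (ϖ ^ n₁ • x) = 0
      rw [act, u₂₁, smul_zero]
    · change galoisAlgebraAction K L (ϖ ^ w₂ • Ψ₂) (ϖ ^ n₂ • y) =
        galoisAlgebraAction K L (algebraMap K _ (algebraMap R K (p ^ _))) (ϖ ^ n₀ • (1 : L))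
      rw [act, u₂₂, hιsmul, hpow (by lia) (sub_add_cancel _ _)]
    · change galoisAlgebraAction K L (ϖ ^ w₂ • Ψ₂) (ϖ ^ n₃ • (x * y)) =
        galoisAlgebraAction K L (algebraMap K _ (algebraMap R K (p ^ _))) (ϖ ^ n₁ • x)
      rw [act, u₂₃, hιsmul, hpow (by lia) (sub_add_cancel _ _)]
    · change galoisAlgebraAction K L (ϖ ^ w₃ • (Ψ₁ * Ψ₂)) (ϖ ^ n₀ • (1 : L)) = 0
      rw [act, map_mul (galoisAlgebraAction K L), Module.End.mul_apply, u₂₀, map_zero, smul_zero]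
    · change galoisAlgebraAction K L (ϖ ^ w₃ • (Ψ₁ * Ψ₂)) (ϖ ^ n₁ • x) = 0
      rw [act, map_mul (galoisAlgebraAction K L), Module.End.mul_apply, u₂₁, map_zero, smul_zero]
    · change galoisAlgebraAction K L (ϖ ^ w₃ • (Ψ₁ * Ψ₂)) (ϖ ^ n₂ • y) = 0
      rw [act, map_mul (galoisAlgebraAction K L), Module.End.mul_apply, u₂₂, u₁₀, smul_zero]
    · change galoisAlgebraAction K L (ϖ ^ w₃ • (Ψ₁ * Ψ₂)) (ϖ ^ n₃ • (x * y)) = ϖ ^ n₀ • (1 : L)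
      rw [act, map_mul (galoisAlgebraAction K L), Module.End.mul_apply, u₂₃, u₁₁, hw₃, sub_add_cancel]

end IsScaffold

/-! ### The structure of the ideal over its associated order -/

theorem isLatticeExponents_ceil (h c₁ c₂ : ℤ) :
    IsLatticeExponents h c₁ c₂ ((h + 3) / 4) ((h + 2 * c₁ + 3) / 4) ((h + c₂ + 3) / 4)
      ((h + 2 * c₁ + c₂ + 3) / 4) := by
  constructor <;> lia

/-- `R` and `S` are the valuation rings of the local fields `K` and `L`. -/
theorem theorem4p3
    {R S K L : Type*}
    [CommRing R] [IsDomain R] [IsDiscreteValuationRing R]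
    [IsAdicComplete (IsLocalRing.maximalIdeal R) R]
    [PerfectField (IsLocalRing.ResidueField R)]
    [Field K] [Algebra R K] [IsFractionRing R K] [CharP K 2]
    [Field L] [Algebra K L] [Algebra R L] [IsScalarTower R K L]
    [FiniteDimensional K L] [IsGalois K L] [IsKleinFour Gal(L/K)]
    [CommRing S] [IsDomain S] [IsDiscreteValuationRing S]
    [Algebra S L] [IsFractionRing S L]
    [Algebra R S] [IsScalarTower R S L] [IsIntegralClosure S R L]
    (totallyRamified : (IsLocalRing.maximalIdeal R).map (algebraMap R S) =
      IsLocalRing.maximalIdeal S ^ Module.finrank K L)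
    (b₁ b₂ : ℤ) (hb₁ : IsLowerBreak R S K L 2 2 1 b₁) (hb₂ : IsLowerBreak R S K L 2 2 2 b₂)
    (h : ℤ) :
    (Module.Free (associatedOrder K (primePow S L h)) (primePow S L h) ↔
      (b₁ ≡ 1 [ZMOD 4] ∧ ¬ h ≡ 2 [ZMOD 4]) ∨ (b₁ ≡ 3 [ZMOD 4] ∧ ¬ h ≡ 1 [ZMOD 4])) ∧
    (¬ Module.Free (associatedOrder K (primePow S L h)) (primePow S L h) →
      (⊤ : Submodule (associatedOrder K (primePow S L h)) (primePow S L h)).spanRank = 3) ∧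
    ∃ _ : IsLocalRing (associatedOrder K (primePow S L h)),
      ((b₂ ≡ 1 [ZMOD 4] ∧ h ≡ 1 [ZMOD 2]) ∨ (b₂ ≡ 3 [ZMOD 4] ∧ h ≡ 0 [ZMOD 2]) →
        Module.finrank (IsLocalRing.ResidueField (associatedOrder K (primePow S L h)))
          (IsLocalRing.CotangentSpace (associatedOrder K (primePow S L h))) = 3) ∧
      (¬ ((b₂ ≡ 1 [ZMOD 4] ∧ h ≡ 1 [ZMOD 2]) ∨ (b₂ ≡ 3 [ZMOD 4] ∧ h ≡ 0 [ZMOD 2])) →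
        Module.finrank (IsLocalRing.ResidueField (associatedOrder K (primePow S L h)))
          (IsLocalRing.CotangentSpace (associatedOrder K (primePow S L h))) = 4) := by
  have hdim : Module.finrank K L = 4 := by
    rw [← IsGalois.card_aut_eq_finrank, IsKleinFour.card_four]
  rw [hdim] at totallyRamified
  have hK : ∀ x : K, x ≠ 0 → ord S (algebraMap K L x) = 4 * ord R x :=
    fun x hx => ord_algebraMap_of_ramified totallyRamified hx
  obtain ⟨σ₁, σ₂, x, y, μ, c₁, c₂, H⟩ := exists_isScaffold hdim hK (ord_galois (R := R) (S := S))
  obtain rfl : b₁ = c₁ := hb₁.unique (H.isLowerBreak_one hK hdim)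
  obtain rfl : b₂ = c₂ := hb₂.unique (H.isLowerBreak_two hK hdim)
  obtain ⟨p, hp⟩ := IsDiscreteValuationRing.exists_irreducible R
  have hodd := H.odd
  have hmod := H.mod_four
  have N := isLatticeExponents_ceil h b₁ b₂
  generalize (h + 3) / 4 = n₀, (h + 2 * b₁ + 3) / 4 = n₁, (h + b₂ + 3) / 4 = n₂,
    (h + 2 * b₁ + b₂ + 3) / 4 = n₃ at N
  obtain ⟨w₁, hw₁⟩ : ∃ w, w = max (n₀ - n₁) (n₂ - n₃) := ⟨_, rfl⟩
  obtain ⟨w₂, hw₂⟩ : ∃ w, w = max (n₀ - n₂) (n₁ - n₃) := ⟨_, rfl⟩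
  obtain ⟨w₃, hw₃⟩ : ∃ w, w = n₀ - n₃ := ⟨_, rfl⟩
  obtain ⟨ι, Φ₁, Φ₂, Φ₃, E₀, E₁, E₂, E₃, c, d, HA, HM⟩ :=
    H.exists_isMonomialOrder hK N hp hdim hw₁ hw₂ hw₃
  obtain ⟨N₁, N₂, N₃, N₄, N₅, N₆, N₇, N₈⟩ := N
  have hunit : ∀ {m : ℤ}, m = 0 → IsUnit (p ^ m.toNat) := by
    rintro _ rfl
    simp
  have hdvd : ∀ {m : ℤ}, 0 < m → p ∣ p ^ m.toNat := fun hm => dvd_pow_self p (by lia)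
  rw [Int.ModEq] at hmod
  -- Everything is decided by the sign of `n₀ + n₃ - n₁ - n₂`, which lies in `{-1, 0, 1}`.
  have hfree : n₀ + n₃ ≤ n₁ + n₂ →
      Module.Free (associatedOrder K (primePow S L h)) (primePow S L h) := fun hle =>
    HM.free_of_isUnit HA (hunit (by lia)) (hunit (by lia))
  have hlocal : IsLocalRing (associatedOrder K (primePow S L h)) := HA.isLocalRing
  have hrank : n₁ + n₂ < n₀ + n₃ →
      ¬ Module.Free (associatedOrder K (primePow S L h)) (primePow S L h) ∧
      (⊤ : Submodule (associatedOrder K (primePow S L h)) (primePow S L h)).spanRank = 3 :=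
    fun hlt => ⟨HM.not_free_of_dvd HA hp (hdvd (by lia)) (hdvd (by lia)),
      HM.spanRank_of_dvd HA hp (hdvd (by lia)) (hdvd (by lia))⟩
  refine ⟨⟨fun hf => ?_, fun hcond => hfree ?_⟩, fun hnf => (hrank ?_).2, hlocal,
    fun hcond => ?_, fun hcond => ?_⟩
  · have hle : n₀ + n₃ ≤ n₁ + n₂ := by
      by_contra! hlt
      exact (hrank hlt).1 hf
    simp only [Int.ModEq]
    lia
  · simp only [Int.ModEq] at hcond
    lia
  · by_contra! hle
    exact hnf (hfree hle)
  · refine HA.finrank_cotangentSpace_of_isUnit hp (hunit ?_)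
    simp only [Int.ModEq] at hcond
    lia
  · refine HA.finrank_cotangentSpace_of_dvd hp (hdvd ?_)
    simp only [Int.ModEq] at hcond
    lia
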